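/- For $\mathbb K=\mathbb R$ or $\mathbb C$, give $\mathbb K\mathbb P^n$ ($n\ge 0$) its usual topology. A set $D\subset\mathbb R\mathbb P^n$ is *convex* if it contains no projective line and its intersection with every projective line is connected (possibly empty). A set $E\subset\mathbb C\mathbb P^n$ is *$\mathbb C$-convex* if it contains no projective line and its intersection with every projective line is empty or is connected and simply connected. Write $[v]$ for the point of projective space given by a nonzero vector $v$. For nonzero $v_0,v_1\in\mathbb R^{n+1}$ (possibly proportional), the closed segment $I$ determined by $v_0,v_1$, and the associated closed disc $I^e$, are $$I=\{[c_0v_0+c_1v_1] : c_0,c_1\in\mathbb R,\ c_0c_1\ge 0\}\subset\mathbb R\mathbb P^n,\qquad I^e=\{[c_0v_0+c_1v_1] : c_0,c_1\in\mathbb C,\ \operatorname{Re}(c_0\overline{c_1})\ge 0\}\subset\mathbb C\mathbb P^n,$$ where only nonzero vectors $c_0v_0+c_1v_1$ are used. The *elliptic tube* of $D\subset\mathbb R\mathbb P^n$ is $$D^e=\bigcup\{I^e : I\subset D\text{ a closed segment}\}\subset\mathbb C\mathbb P^n;$$ the same definition, with $(\mathbb R^{n+1})^*\subset(\mathbb C^{n+1})^*$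 (extend functionals $\mathbb C$-linearly), is used for subsets of the dual projective space $(\mathbb R\mathbb P^n)^*$. The *dual complement* $E^*$ of a set $E$ in a projective space is the set of all projective hyperplanes disjoint from $E$; for a set $F$ in the dual projective space, $F^*$ is the set of all points of the original projective space that lie on no hyperplane belonging to $F$. **Corollary.** Let $D\subset\mathbb R\mathbb P^n$ be a compact convex set. Then $D^e$ is $\mathbb C$-convex. Moreover, if $D\neq\emptyset$, then $(D^*)^e\subset(\mathbb C\mathbb P^n)^*$ is open and $\mathbb C$-convex, and $D^e=((D^*)^e)^*$. -/

import Mathlib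

open scoped LinearAlgebra.Projectivization

noncomputable section

namespace EllipticTube

/-- The quotient topology on a projective space. -/
instance projTopology (K V : Type*) [DivisionRing K] [AddCommGroup V] [Module K V]
    [TopologicalSpace V] : TopologicalSpace (ℙ K V) :=
  inferInstanceAs (TopologicalSpace (Quotient (projectivizationSetoid K V)))

section Duality

variable {K V : Type*} [NormedField K] [NormedAddCommGroup V] [NormedSpace K V]

/-- The kernel of a point `ξ` of the dual projective space, as a set of points of the projective
space. (The functional is only defined up to a nonzero scalar; its kernel is well defined. In
finite dimension every linear functional is continuous.) -/
def ker (ξ : ℙ K (StrongDual K V)) : Set (ℙ K V) :=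
  {x | ξ.rep x.rep = 0}

/-- The annihilator of a point `x`: all projective hyperplanes through `x`. -/
def ann (x : ℙ K V) : Set (ℙ K (StrongDual K V)) :=
  {ξ | x ∈ ker ξ}

/-- The dual complement of `E ⊆ ℙ(V)`: all projective hyperplanes disjoint from `E`. -/
def dualComplement (E : Set (ℙ K V)) : Set (ℙ K (StrongDual K V)) :=
  {ξ | ker ξ ∩ E = ∅}

/-- The dual complement of a set `F ⊆ ℙ(V*)`, regarded as a subset of `ℙ(V)` through the canonical
identification of `V` with its bidual. -/
def dualComplement' (F : Set (ℙ K (StrongDual K V))) : Set (ℙ K V) :=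
  {x | ann x ∩ F = ∅}

end Duality

/-- A set in a real projective space is convex if it contains no projective line and meets every
projective line in a connected (possibly empty) set. -/
def IsConvex {V : Type*} [NormedAddCommGroup V] [NormedSpace ℝ V] (D : Set (ℙ ℝ V)) : Prop :=
  ∀ W : Submodule ℝ V, Module.finrank ℝ W = 2 →
    ¬ ((W.projectivization : Set (ℙ ℝ V)) ⊆ D) ∧
      IsPreconnected (D ∩ (W.projectivization : Set (ℙ ℝ V)))

/-- A set in a complex projective space is `ℂ`-convex if it contains no projective line and meets
every projective line in a connected and simply connected (possibly empty) set. -/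
def IsCConvex {V : Type*} [NormedAddCommGroup V] [NormedSpace ℂ V] (E : Set (ℙ ℂ V)) : Prop :=
  ∀ W : Submodule ℂ V, Module.finrank ℂ W = 2 →
    ¬ ((W.projectivization : Set (ℙ ℂ V)) ⊆ E) ∧
      IsPreconnected (E ∩ (W.projectivization : Set (ℙ ℂ V))) ∧
      ((E ∩ (W.projectivization : Set (ℙ ℂ V))).Nonempty →
        IsSimplyConnected (E ∩ (W.projectivization : Set (ℙ ℂ V))))

section Tube

variable {V W : Type*} [AddCommGroup V] [Module ℝ V] [AddCommGroup W] [Module ℂ W]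

/-- The closed segment with extremes `[v₀]` and `[v₁]`, consisting of the classes of the nonzero
vectors `c₀ v₀ + c₁ v₁` with `c₀ c₁ ≥ 0`. Replacing `v₁` by `- v₁` gives the other segment with the
same extremes. For proportional `v₀`, `v₁` it is a single point. -/
def closedSegment (v₀ v₁ : V) : Set (ℙ ℝ V) :=
  {x | ∃ c₀ c₁ : ℝ, 0 ≤ c₀ * c₁ ∧
    ∃ h : c₀ • v₀ + c₁ • v₁ ≠ 0, x = Projectivization.mk ℝ (c₀ • v₀ + c₁ • v₁) h}

/-- The closed disc having as a diameter the closed segment given by `v₀`, `v₁`, in the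
complexified line. Here `ι : V → W` is the inclusion of `V` into its complexification `W`. -/
def closedDisc (ι : V → W) (v₀ v₁ : V) : Set (ℙ ℂ W) :=
  {z | ∃ c₀ c₁ : ℂ, 0 ≤ (c₀ * (starRingEnd ℂ) c₁).re ∧
    ∃ h : c₀ • ι v₀ + c₁ • ι v₁ ≠ 0, z = Projectivization.mk ℂ (c₀ • ι v₀ + c₁ • ι v₁) h}

/-- The elliptic tube with base `D`: the union of the closed discs having as a diameter a closed
segment contained in `D`. -/
def ellipticTube (ι : V → W) (D : Set (ℙ ℝ V)) : Set (ℙ ℂ W) :=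
  {z | ∃ v₀ v₁ : V, v₀ ≠ 0 ∧ v₁ ≠ 0 ∧ closedSegment v₀ v₁ ⊆ D ∧ z ∈ closedDisc ι v₀ v₁}

end Tube

/-- The inclusion `ℝⁿ⁺¹ ⊆ ℂⁿ⁺¹`. -/
def complexify {n : ℕ} (v : Fin (n + 1) → ℝ) : Fin (n + 1) → ℂ :=
  fun i => (v i : ℂ)

/-- The inclusion `(ℝⁿ⁺¹)* ⊆ (ℂⁿ⁺¹)*`, sending a real functional to its `ℂ`-linear extension
`z ↦ ∑ i, ξ(eᵢ) zᵢ`. -/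
def complexifyDual {n : ℕ} (ξ : StrongDual ℝ (Fin (n + 1) → ℝ)) :
    StrongDual ℂ (Fin (n + 1) → ℂ) :=
  ∑ i, ((ξ (Pi.single i 1) : ℝ) : ℂ) • ContinuousLinearMap.proj (R := ℂ) i

/-- The elliptic tube in `ℂℙⁿ` of a subset of `ℝℙⁿ`. -/
def tube {n : ℕ} (D : Set (ℙ ℝ (Fin (n + 1) → ℝ))) : Set (ℙ ℂ (Fin (n + 1) → ℂ)) :=
  ellipticTube complexify D

/-- The elliptic tube in `(ℂℙⁿ)*` of a subset of `(ℝℙⁿ)*`. -/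
def dualTube {n : ℕ} (F : Set (ℙ ℝ (StrongDual ℝ (Fin (n + 1) → ℝ)))) :
    Set (ℙ ℂ (StrongDual ℂ (Fin (n + 1) → ℂ))) :=
  ellipticTube complexifyDual F

end EllipticTube

end

/-! The theorem reduces to convex cones. A nonempty compact convex `D` is the set of classes of a
convex cone `C` with `C ∩ -C = ∅` and `C ∪ {0}` closed (`exists_cone`): fix a vector `v₀` over `D`
and choose, for every other point of `D`, the sign of its representative that is joined to `v₀`
inside `D`. That these choices form a convex cone is a connectedness argument
(`segmentIn_of_common`).

The condition `Re (c₀ * conj c₁) ≥ 0` says that the two coefficients can be rotated together into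
the closed first quadrant. Hence a point lies in the tube of `D` exactly when it has a
representative in `C + iC` (`mk_mem_ellipticTube`). The hyperplanes missing `D` come from `P` or
`-P`, where `P` is the open cone of functionals positive on `C`, so the dual tube is given in the
same way by `P + iP`, and is open.

For `ℂ`-convexity, a section by a projective line is the image of a real convex cone `M` under
passage to complex classes, and it is shown to be contractible. If `M` is open, representatives in
`M` can be chosen continuously, so the section is a retract of a convex set. If `M` is closed, such
a choice need not be locally constant; instead a compact convex base of `M` maps onto the section
with convex fibres, and approximate sections built by partitions of unity give a contraction. A
functional positive on `C`, extended `ℂ`-linearly, vanishes nowhere on the tube and so excludes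
whole lines.

For the duality, if no functional in `P + iP` vanishes at `z`, their values at `z` form an open
convex subset of `ℂ` missing `0`. A real line separating it from `0` yields the scalar that carries
`z` into the closure of `C + iC`, by the bipolar theorem. -/

namespace EllipticTube

open Topology Set

/-! ### Topology of projective space and affine charts -/

section Projective

variable {K V : Type*} [NormedField K] [NormedAddCommGroup V] [NormedSpace K V]

theorem continuous_mk' : Continuous (Projectivization.mk' K : {v : V // v ≠ 0} → ℙ K V) :=
  continuous_quotient_mk'

theorem continuous_mk {X : Type*} [TopologicalSpace X] {f : X → V} (hf : Continuous f)
    (h : ∀ x, f x ≠ 0) : Continuous fun x => Projectivization.mk K (f x) (h x) :=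
  continuous_mk'.comp (hf.subtype_mk h)

theorem isOpenQuotientMap_mk' :
    IsOpenQuotientMap (Projectivization.mk' K : {v : V // v ≠ 0} → ℙ K V) := by
  refine ⟨Quotient.mk''_surjective, continuous_mk', fun U hU => ?_⟩
  refine isQuotientMap_quot_mk.isOpen_preimage.1 ?_
  -- The saturation of an open set is the union of its preimages under multiplication by units.
  have key : Quot.mk _ ⁻¹' (Projectivization.mk' K '' U) =
      ⋃ c : Kˣ, (fun v : {v : V // v ≠ 0} =>
        (⟨c • v.1, (smul_ne_zero_iff_ne c).2 v.2⟩ : {v : V // v ≠ 0})) ⁻¹' U := by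
    ext ⟨v, hv⟩
    simp only [mem_preimage, mem_iUnion]
    constructor
    · rintro ⟨⟨w, hw⟩, hwU, h⟩
      obtain ⟨c, rfl⟩ := (Projectivization.mk_eq_mk_iff K w v hw hv).1 h
      exact ⟨c, hwU⟩
    · rintro ⟨c, hc⟩
      exact ⟨_, hc, (Projectivization.mk_eq_mk_iff K _ v _ hv).2 ⟨c, rfl⟩⟩
  exact key ▸ isOpen_iUnion fun c => hU.preimage (by fun_prop)

/-- The affine chart of projective space on the complement of the hyperplane `Φ = 0`, with values
in the affine hyperplane `Φ = 1`. -/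
noncomputable def affineChart (Φ : StrongDual K V) : ℙ K V → V :=
  Projectivization.lift (fun v => (Φ v.1)⁻¹ • v.1) (by
    rintro ⟨a, ha⟩ ⟨b, hb⟩ t rfl
    have ht : t ≠ 0 := fun h => ha (by simp [h])
    simp only [map_smul, smul_eq_mul, mul_inv, smul_smul]
    congr 1
    field_simp)

theorem affineChart_mk (Φ : StrongDual K V) (v : V) (hv : v ≠ 0) :
    affineChart Φ (Projectivization.mk K v hv) = (Φ v)⁻¹ • v := rfl

theorem continuousAt_affineChart (Φ : StrongDual K V) {v : V} (hv : v ≠ 0) (h : Φ v ≠ 0) :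
    ContinuousAt (affineChart Φ) (Projectivization.mk K v hv) := by
  refine (isOpenQuotientMap_mk'.continuousAt_comp_iff
    (x := (⟨v, hv⟩ : {v : V // v ≠ 0})) (f := Projectivization.mk' K)).1 ?_
  change ContinuousAt (fun w : {v : V // v ≠ 0} => (Φ w.1)⁻¹ • w.1) ⟨v, hv⟩
  have h1 : Continuous fun w : {v : V // v ≠ 0} => Φ w.1 := Φ.continuous.comp continuous_subtype_val
  exact (h1.continuousAt.inv₀ h).smul continuous_subtype_val.continuousAt

theorem affineChart_injective (Φ : StrongDual K V) {v w : V} (hv : v ≠ 0) (hw : w ≠ 0)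
    (h : Φ v ≠ 0)
    (e : affineChart Φ (Projectivization.mk K v hv) = affineChart Φ (Projectivization.mk K w hw)) :
    Projectivization.mk K v hv = Projectivization.mk K w hw := by
  rw [affineChart_mk, affineChart_mk] at e
  refine (Projectivization.mk_eq_mk_iff' K v w hv hw).2 ⟨Φ v * (Φ w)⁻¹, ?_⟩
  rw [mul_smul, ← e, smul_smul, mul_inv_cancel₀ h, one_smul]

end Projective

/-- Some functional is nonzero on both given vectors; its chart is continuous at both points and
takes distinct values there. -/
theorem t2Space_projectivization {V : Type*} [NormedAddCommGroup V] [NormedSpace ℝ V] :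
    T2Space (ℙ ℝ V) := by
  refine ⟨fun x y hxy => ?_⟩
  induction x with | h v hv => ?_
  induction y with | h w hw => ?_
  obtain ⟨Φ, hΦv, hΦw⟩ : ∃ Φ : StrongDual ℝ V, Φ v ≠ 0 ∧ Φ w ≠ 0 := by
    obtain ⟨f, -, hf⟩ := exists_dual_vector ℝ v (norm_ne_zero_iff.2 hv)
    obtain ⟨g, -, hg⟩ := exists_dual_vector ℝ w (norm_ne_zero_iff.2 hw)
    have hf' : f v ≠ 0 := by rw [hf]; simpa using hv
    have hg' : g w ≠ 0 := by rw [hg]; simpa using hw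
    by_cases h1 : f w = 0
    · by_cases h2 : g v = 0
      · exact ⟨f + g, by simpa [h2] using hf', by simpa [h1] using hg'⟩
      · exact ⟨g, h2, hg'⟩
    · exact ⟨f, hf', h1⟩
  have hne : affineChart Φ (Projectivization.mk ℝ v hv) ≠
      affineChart Φ (Projectivization.mk ℝ w hw) :=
    fun e => hxy (affineChart_injective Φ hv hw hΦv e)
  obtain ⟨a, b, ha, hb, hab⟩ := t2_separation_nhds hne
  obtain ⟨s, hs, hso, hvs⟩ := mem_nhds_iff.1 ((continuousAt_affineChart Φ hv hΦv) ha)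
  obtain ⟨t, ht, hto, hwt⟩ := mem_nhds_iff.1 ((continuousAt_affineChart Φ hw hΦw) hb)
  exact ⟨s, t, hso, hto, hvs, hwt,
    disjoint_left.2 fun p hp hq => disjoint_left.1 hab (hs hp) (ht hq)⟩

/-! ### Contractibility criteria -/

section Contractible

theorem contractibleSpace_of_retract {X Y : Type*} [TopologicalSpace X] [TopologicalSpace Y]
    [ContractibleSpace Y] (i : C(X, Y)) (r : C(Y, X)) (h : ∀ x, r (i x) = x) :
    ContractibleSpace X := by
  rw [contractible_iff_id_nullhomotopic]
  have e : ContinuousMap.id X = r.comp ((ContinuousMap.id Y).comp i) := by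
    ext x; simp [h]
  rw [e]
  exact ((id_nullhomotopic Y).comp_left i).comp_right r

open unitInterval in
/-- The image of a compact convex set under a continuous map with convex fibres is contractible. -/
theorem contractibleSpace_of_convex_fibers {F X : Type*} [NormedAddCommGroup F] [NormedSpace ℝ F]
    [MetricSpace X] {B : Set F} (hB : IsCompact B) (hconv : Convex ℝ B) (hne : B.Nonempty)
    (p : B → X) (hp : Continuous p) (hsurj : Function.Surjective p)
    (hfib : ∀ x, Convex ℝ (Subtype.val '' (p ⁻¹' {x}))) : ContractibleSpace X := by
  have : CompactSpace B := isCompact_iff_compactSpace.1 hB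
  have : ContractibleSpace B := hconv.contractibleSpace hne
  have hsub : ∀ s : Set B, convexHull ℝ (Subtype.val '' s) ⊆ B := fun s =>
    convexHull_min (by rintro _ ⟨b, -, rfl⟩; exact b.2) hconv
  -- hulls of preimages of small balls map to small sets
  have small : ∀ x : X, ∀ U ∈ 𝓝 x, ∃ δ > 0, ∀ b : B,
      b.1 ∈ convexHull ℝ (Subtype.val '' (p ⁻¹' Metric.ball x δ)) → p b ∈ U := by
    intro x U hU
    obtain ⟨O, hOU, hO, hxO⟩ := mem_nhds_iff.1 hU
    obtain ⟨G, hG, hGO⟩ := isOpen_induced_iff.1 (hO.preimage hp)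
    have hcpt : IsCompact (Subtype.val '' (p ⁻¹' {x})) :=
      ((isClosed_singleton.preimage hp).isCompact).image continuous_subtype_val
    obtain ⟨ε, hε, hεG⟩ := hcpt.exists_thickening_subset_open hG (by
      rintro _ ⟨b, hb, rfl⟩
      have : b ∈ p ⁻¹' O := by simpa [mem_preimage, mem_singleton_iff.1 hb] using hxO
      rwa [← hGO] at this)
    set T := Metric.thickening ε (Subtype.val '' (p ⁻¹' {x})) with hT
    have hTo : IsOpen T := Metric.isOpen_thickening
    -- `B` is compact, so `p` is closed: fibres over points near `x` stay in the thickening `T`. A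
    -- thickening of a convex set is convex, so `T` contains the hulls as well.
    have hcl : IsClosed (p '' (Subtype.val ⁻¹' T)ᶜ) :=
      ((hTo.preimage continuous_subtype_val).isClosed_compl.isCompact.image hp).isClosed
    have hx : x ∈ (p '' (Subtype.val ⁻¹' T)ᶜ)ᶜ := by
      rintro ⟨b, hb, hbx⟩
      exact hb (Metric.self_subset_thickening hε _ ⟨b, hbx, rfl⟩)
    obtain ⟨δ, hδ, hball⟩ := Metric.isOpen_iff.1 hcl.isOpen_compl x hx
    refine ⟨δ, hδ, fun b hb => hOU ?_⟩
    have h1 : Subtype.val '' (p ⁻¹' Metric.ball x δ) ⊆ T := by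
      rintro _ ⟨c, hc, rfl⟩
      by_contra hcT
      exact hball hc ⟨c, hcT, rfl⟩
    have h2 : b.1 ∈ G := hεG (convexHull_min h1 ((hfib x).thickening ε) hb)
    have h3 : b ∈ p ⁻¹' O := hGO ▸ h2
    exact h3
  -- An approximate section of `p`: `s (x, t)` lies in the hull of the preimage of the ball of
  -- radius `t` about `x`, so `p ∘ s` tends to the identity as `t → 0`, locally uniformly enough for
  -- joint continuity.
  obtain ⟨s, hs⟩ := exists_continuous_forall_mem_convex_of_local_const
    (X := X × Set.Ioi (0 : ℝ)) (E := F)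
    (t := fun q => convexHull ℝ (Subtype.val '' (p ⁻¹' Metric.ball q.1 q.2.1)))
    (fun q => convex_convexHull ℝ _) (by
      rintro ⟨x, t, ht⟩
      obtain ⟨b, rfl⟩ := hsurj x
      refine ⟨b.1, ?_⟩
      have : ∀ᶠ q : X × Set.Ioi (0 : ℝ) in 𝓝 (p b, ⟨t, ht⟩), dist (p b) q.1 < q.2.1 :=
        (isOpen_lt (by fun_prop) (by fun_prop)).mem_nhds (by simpa using ht)
      filter_upwards [this] with q hq
      exact subset_convexHull ℝ _ ⟨b, hq, rfl⟩)
  have hsB : ∀ q, s q ∈ B := fun q => hsub _ (hs q)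
  let r : C(X × Set.Ioi (0 : ℝ), X) := ⟨fun q => p ⟨s q, hsB q⟩, by fun_prop⟩
  have hr : ∀ x : X, ∀ U ∈ 𝓝 x, ∃ δ > 0, ∀ y, dist y x < δ → ∀ t : Set.Ioi (0 : ℝ), t.1 < δ →
      r (y, t) ∈ U := by
    intro x U hU
    obtain ⟨δ, hδ, h⟩ := small x U hU
    refine ⟨δ / 2, by positivity, fun y hy t ht => h _ ?_⟩
    refine convexHull_mono (image_mono (preimage_mono ?_)) (hs (y, t))
    exact Metric.ball_subset_ball' (by linarith)
  let H : X × I → X := fun q => if h : 0 < q.2.1 then r (q.1, ⟨q.2.1, h⟩) else q.1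
  have hH : Continuous H := by
    rw [continuous_iff_continuousAt]
    rintro ⟨x, t⟩
    by_cases ht : 0 < t.1
    · have hopen : IsOpen {q : X × I | 0 < q.2.1} := isOpen_lt (by fun_prop) (by fun_prop)
      have : ContinuousOn H {q : X × I | 0 < q.2.1} := by
        rw [continuousOn_iff_continuous_domRestrict]
        have e : Set.domRestrict {q : X × I | 0 < q.2.1} H =
            fun q => r (q.1.1, ⟨q.1.2.1, q.2⟩) := by
          ext q
          exact dif_pos q.2
        rw [e]
        fun_prop
      exact this.continuousAt (hopen.mem_nhds ht)
    · have hHx : H (x, t) = x := dif_neg ht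
      rw [ContinuousAt, hHx]
      intro U hU
      obtain ⟨δ, hδ, h⟩ := hr x U hU
      obtain ⟨δ', hδ', h'⟩ := Metric.mem_nhds_iff.1 hU
      have ht0 : t.1 = 0 := le_antisymm (not_lt.1 ht) t.2.1
      have : ∀ᶠ q : X × I in 𝓝 (x, t), dist q.1 x < min δ δ' ∧ q.2.1 < δ :=
        ((isOpen_lt (f := fun q : X × I => dist q.1 x) (by fun_prop)
          continuous_const).eventually_mem (by
            change dist x x < min δ δ'
            simpa using ⟨hδ, hδ'⟩)).and
        ((isOpen_lt (f := fun q : X × I => q.2.1) (by fun_prop)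
          continuous_const).eventually_mem (by
            change t.1 < δ
            simpa [ht0] using hδ))
      refine Filter.mem_map.2 ?_
      filter_upwards [this] with q hq
      rw [lt_min_iff] at hq
      by_cases h0 : 0 < q.2.1
      · have : H q = r (q.1, ⟨q.2.1, h0⟩) := dif_pos h0
        rw [mem_preimage, this]
        exact h _ hq.1.1 _ hq.2
      · have : H q = q.1 := dif_neg h0
        rw [mem_preimage, this]
        exact h' hq.1.2
  let s₁ : C(X, B) := ⟨fun x => ⟨s (x, ⟨1, mem_Ioi.2 one_pos⟩), hsB _⟩, by fun_prop⟩
  let p' : C(B, X) := ⟨p, hp⟩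
  -- The identity is deformed to a map factoring through the contractible space `B`.
  have hom : (ContinuousMap.id X).Homotopic (p'.comp ((ContinuousMap.id B).comp s₁)) := by
    refine ⟨{ toFun := fun q => H (q.2, q.1)
              continuous_toFun := by fun_prop
              map_zero_left := fun x => ?_
              map_one_left := fun x => ?_ }⟩
    · exact dif_neg (by simp)
    · exact dif_pos (by simp)
  rw [contractible_iff_id_nullhomotopic]
  obtain ⟨y, hy⟩ := ((id_nullhomotopic B).comp_left s₁).comp_right p'
  exact ⟨y, hom.trans hy⟩

end Contractible

/-! ### Projective images of convex cones are contractible -/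

section Lines

variable {E : Type*} [NormedAddCommGroup E] [NormedSpace ℂ E]

theorem mk_affineChart (Φ : StrongDual ℂ E) {t : ℙ ℂ E} (h : Φ t.rep ≠ 0) :
    ∃ h : affineChart Φ t ≠ 0, Projectivization.mk ℂ (affineChart Φ t) h = t := by
  have e : affineChart Φ t = (Φ t.rep)⁻¹ • t.rep := by
    conv_lhs => rw [← t.mk_rep, affineChart_mk]
  have h0 : affineChart Φ t ≠ 0 := by
    rw [e]; exact smul_ne_zero (inv_ne_zero h) t.rep_nonzero
  refine ⟨h0, ?_⟩
  conv_rhs => rw [← t.mk_rep]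
  exact (Projectivization.mk_eq_mk_iff' ℂ _ _ _ _).2 ⟨(Φ t.rep)⁻¹, e.symm⟩

theorem continuous_affineChart_comp (Φ : StrongDual ℂ E) {T : Set (ℙ ℂ E)}
    (hT : ∀ t ∈ T, Φ t.rep ≠ 0) : Continuous fun t : T => affineChart Φ t.1 := by
  rw [continuous_iff_continuousAt]
  rintro ⟨t, ht⟩
  refine ContinuousAt.comp (g := affineChart Φ) ?_ continuous_subtype_val.continuousAt
  have := continuousAt_affineChart Φ t.rep_nonzero (hT t ht)
  rwa [t.mk_rep] at this

/-- Every two-dimensional subspace meets the kernel of `Φ` nontrivially, so `T` contains no line;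
contractible sections are connected and simply connected. -/
theorem isCConvex_of_contractible (Φ : StrongDual ℂ E) {T : Set (ℙ ℂ E)}
    (hT : ∀ t ∈ T, Φ t.rep ≠ 0)
    (h : ∀ W : Submodule ℂ E, Module.finrank ℂ W = 2 →
      (T ∩ (W.projectivization : Set (ℙ ℂ E))).Nonempty →
      ContractibleSpace ↥(T ∩ (W.projectivization : Set (ℙ ℂ E)))) : IsCConvex T := by
  intro W hW
  refine ⟨fun hsub => ?_, ?_, fun hne => ?_⟩
  · have : FiniteDimensional ℂ W := Module.finite_of_finrank_pos (by omega)
    have hker : LinearMap.ker (Φ.toLinearMap.comp W.subtype) ≠ ⊥ := by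
      refine LinearMap.ker_ne_bot_of_finrank_lt ?_
      rw [hW]; simp
    obtain ⟨w, hw, hw0⟩ := Submodule.exists_mem_ne_zero_of_ne_bot hker
    have hw1 : w.1 ≠ 0 := fun h => hw0 (Subtype.ext h)
    have hmem := hT _ (hsub ((W.mk_mem_projectivization_iff hw1).2 w.2))
    obtain ⟨a, ha⟩ := Projectivization.exists_smul_eq_mk_rep ℂ w.1 hw1
    rw [← ha] at hmem
    have hw' : Φ w.1 = 0 := hw
    exact hmem (by rw [Units.smul_def, map_smul, hw', smul_zero])
  · rcases eq_empty_or_nonempty (T ∩ (W.projectivization : Set (ℙ ℂ E))) with he | hne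
    · rw [he]; exact isPreconnected_empty
    · have := h W hW hne
      exact isPreconnected_iff_preconnectedSpace.2 inferInstance
  · have := h W hW hne
    change SimplyConnectedSpace _
    infer_instance

variable [NormedSpace ℝ E] [IsScalarTower ℝ ℂ E]

/-- For a normalized representative `x`, the scalars `l` with `l • x ∈ M ∩ W` form a convex set, and
since `M` is open an admissible `l` stays admissible nearby. A continuous choice of `l` therefore
exists and exhibits `T` as a retract of the convex set `M ∩ W`. -/
theorem contractibleSpace_of_open_cone (Φ : StrongDual ℂ E) {T : Set (ℙ ℂ E)} {W : Submodule ℂ E}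
    {M : Set E} (hM : IsOpen M) (hadd : ∀ x ∈ M, ∀ y ∈ M, x + y ∈ M)
    (hsmul : ∀ c : ℝ, 0 < c → ∀ x ∈ M, c • x ∈ M) (hΦ : ∀ x ∈ M, Φ x ≠ 0)
    (hT : ∀ z hz, Projectivization.mk ℂ z hz ∈ T ↔ ∃ l : ℂ, l ≠ 0 ∧ l • z ∈ M ∩ W)
    (hne : T.Nonempty) : ContractibleSpace T := by
  have hTΦ : ∀ t ∈ T, Φ t.rep ≠ 0 := by
    intro t ht h0
    rw [← t.mk_rep, hT] at ht
    obtain ⟨l, -, hl, -⟩ := ht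
    exact hΦ _ hl (by rw [map_smul, h0, smul_zero])
  have hconv : ∀ x ∈ M ∩ (W : Set E), ∀ y ∈ M ∩ (W : Set E), ∀ a b : ℝ, 0 < a → 0 < b →
      a • x + b • y ∈ M ∩ (W : Set E) := fun x hx y hy a b ha hb =>
    ⟨hadd _ (hsmul a ha x hx.1) _ (hsmul b hb y hy.1),
      W.add_mem (W.smul_of_tower_mem a hx.2) (W.smul_of_tower_mem b hy.2)⟩
  have hMconv : Convex ℝ (M ∩ (W : Set E)) := convex_iff_forall_pos.2
    fun x hx y hy a b ha hb _ => hconv x hx y hy a b ha hb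
  have hchart : ∀ t : T, ∃ l : ℂ, l • affineChart Φ t.1 ∈ M ∩ (W : Set E) := by
    rintro ⟨t, ht⟩
    obtain ⟨h0, h1⟩ := mk_affineChart Φ (hTΦ t ht)
    rw [← h1, hT] at ht
    obtain ⟨l, -, hl⟩ := ht
    exact ⟨l, hl⟩
  have hchartW : ∀ t : T, affineChart Φ t.1 ∈ W := by
    intro t
    obtain ⟨l, hl⟩ := hchart t
    have hl0 : l ≠ 0 := by
      rintro rfl
      exact hΦ _ hl.1 (by simp)
    exact (W.smul_mem_iff hl0).1 hl.2
  -- The selection takes place over the chart image, which is metrizable and hence admits partitions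
  -- of unity.
  let X := (fun t : T => affineChart Φ t.1) '' univ
  have hX : ∀ x : X, x.1 ∈ W := by
    rintro ⟨_, ⟨t, -, rfl⟩⟩
    exact hchartW t
  obtain ⟨g, hg⟩ := exists_continuous_forall_mem_convex_of_local_const
    (X := X) (E := ℂ) (t := fun x => {l : ℂ | l • x.1 ∈ M ∩ (W : Set E)}) (by
      intro x
      refine convex_iff_forall_pos.2 fun l hl m hm a b ha hb _ => ?_
      have := hconv _ hl _ hm a b ha hb
      change (a • l + b • m) • x.1 ∈ M ∩ (W : Set E)
      rwa [add_smul, smul_assoc, smul_assoc]) (by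
      rintro ⟨_, ⟨t, -, rfl⟩⟩
      obtain ⟨l, hl⟩ := hchart t
      refine ⟨l, ?_⟩
      have : ∀ᶠ y : X in 𝓝 ⟨affineChart Φ t.1, ⟨t, trivial, rfl⟩⟩, l • y.1 ∈ M :=
        (hM.preimage (f := fun y : X => l • y.1) (by fun_prop)).mem_nhds hl.1
      filter_upwards [this] with y hy
      exact ⟨hy, W.smul_mem l (hX y)⟩)
  have hMne : (M ∩ (W : Set E)).Nonempty := by
    obtain ⟨t, ht⟩ := hne
    obtain ⟨l, hl⟩ := hchart ⟨t, ht⟩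
    exact ⟨_, hl⟩
  have : ContractibleSpace ↥(M ∩ (W : Set E)) := hMconv.contractibleSpace hMne
  have hM0 : ∀ x : ↥(M ∩ (W : Set E)), x.1 ≠ 0 := fun x h => hΦ _ x.2.1 (by simp [h])
  have hcont := continuous_affineChart_comp Φ hTΦ
  let j : C(T, X) := ⟨fun t => ⟨affineChart Φ t.1, ⟨t, trivial, rfl⟩⟩, hcont.subtype_mk _⟩
  refine contractibleSpace_of_retract (Y := ↥(M ∩ (W : Set E)))
    ⟨fun t => ⟨g (j t) • affineChart Φ t.1, hg (j t)⟩, by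
      exact (((g.comp j).continuous).smul hcont).subtype_mk _⟩
    ⟨fun x => ⟨Projectivization.mk ℂ x.1 (hM0 x), (hT _ _).2 ⟨1, one_ne_zero, by
      rw [one_smul]; exact x.2⟩⟩,
      (continuous_mk continuous_subtype_val hM0).subtype_mk _⟩ ?_
  rintro ⟨t, ht⟩
  refine Subtype.ext ?_
  obtain ⟨h0, h1⟩ := mk_affineChart Φ (hTΦ t ht)
  change Projectivization.mk ℂ (_ • affineChart Φ t) _ = t
  conv_rhs => rw [← h1]
  exact (Projectivization.mk_eq_mk_iff' ℂ _ _ _ _).2 ⟨_, rfl⟩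

/-- The slice of a closed salient cone is compact. -/
theorem isCompact_slice {F : Type*} [NormedAddCommGroup F] [NormedSpace ℝ F]
    [FiniteDimensional ℝ F] {M : Set F} (hM : IsClosed M)
    (hsmul : ∀ c : ℝ, 0 ≤ c → ∀ x ∈ M, c • x ∈ M) (ψ : StrongDual ℝ F)
    (hψ : ∀ x ∈ M, x ≠ 0 → 0 < ψ x) : IsCompact (M ∩ {x | ψ x = 1}) := by
  have hcl : IsClosed (M ∩ {x | ψ x = 1}) :=
    hM.inter (isClosed_eq ψ.continuous continuous_const)
  have hcpt : IsCompact (M ∩ Metric.sphere 0 1) := (isCompact_sphere 0 1).inter_left hM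
  refine Metric.isCompact_of_isClosed_isBounded hcl ?_
  rcases (M ∩ Metric.sphere 0 1).eq_empty_or_nonempty with he | hne
  · refine (Bornology.isBounded_singleton (x := (0 : F))).subset fun x hx => ?_
    by_contra h0
    have hx0 : ‖x‖ ≠ 0 := norm_ne_zero_iff.2 h0
    have : ‖x‖⁻¹ • x ∈ M ∩ Metric.sphere 0 1 :=
      ⟨hsmul _ (by positivity) x hx.1, by simp [norm_smul, hx0]⟩
    rw [he] at this
    exact this
  -- The minimum of `ψ` on the unit vectors of `M` is positive, and its inverse bounds the norm on
  -- the slice.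
  · obtain ⟨m, hm, hmin⟩ := hcpt.exists_isMinOn hne ψ.continuous.continuousOn
    have hm0 : 0 < ψ m := hψ m hm.1 (by
      rintro rfl
      simpa using hm.2)
    refine (Metric.isBounded_closedBall (x := (0 : F)) (r := (ψ m)⁻¹)).subset fun x hx => ?_
    have hx1 : ψ x = 1 := hx.2
    have hx0 : 0 < ‖x‖ := norm_pos_iff.2 (by rintro rfl; simp at hx1)
    have h1 : ‖x‖⁻¹ • x ∈ M ∩ Metric.sphere 0 1 :=
      ⟨hsmul _ (by positivity) x hx.1, by simp [norm_smul, hx0.ne']⟩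
    have h2 : ψ m ≤ ψ (‖x‖⁻¹ • x) := hmin h1
    rw [map_smul, hx1, smul_eq_mul, mul_one] at h2
    rw [mem_closedBall_zero_iff]
    exact (le_inv_comm₀ hm0 hx0).1 h2

/-- The slice `ψ = 1` of `M` is compact and convex and maps onto the chart image of `T`. Its fibres
are its intersections with complex lines through the origin, hence convex, and
`contractibleSpace_of_convex_fibers` applies. -/
theorem contractibleSpace_of_closed_cone [FiniteDimensional ℝ E] (Φ : StrongDual ℂ E)
    {T : Set (ℙ ℂ E)} {M : Set E} (hM : IsClosed M) (hadd : ∀ x ∈ M, ∀ y ∈ M, x + y ∈ M)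
    (hsmul : ∀ c : ℝ, 0 ≤ c → ∀ x ∈ M, c • x ∈ M) (ψ : StrongDual ℝ E)
    (hψ : ∀ x ∈ M, x ≠ 0 → 0 < ψ x) (hΦ : ∀ x ∈ M, x ≠ 0 → Φ x ≠ 0)
    (hT : ∀ z hz, Projectivization.mk ℂ z hz ∈ T ↔ ∃ l : ℂ, l ≠ 0 ∧ l • z ∈ M)
    (hne : T.Nonempty) : ContractibleSpace T := by
  have hTΦ : ∀ t ∈ T, Φ t.rep ≠ 0 := by
    intro t ht h0
    have hr := t.rep_nonzero
    rw [← t.mk_rep, hT] at ht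
    obtain ⟨l, hl0, hl⟩ := ht
    exact hΦ _ hl (smul_ne_zero hl0 hr) (by rw [map_smul, h0, smul_zero])
  let B := M ∩ {x | ψ x = 1}
  have hB : IsCompact B := isCompact_slice hM hsmul ψ hψ
  have hBconv : Convex ℝ B := by
    intro x hx y hy a b ha hb hab
    refine ⟨hadd _ (hsmul a ha x hx.1) _ (hsmul b hb y hy.1), ?_⟩
    have h1 : ψ x = 1 := hx.2
    have h2 : ψ y = 1 := hy.2
    simp [h1, h2, hab]
  have hB0 : ∀ x ∈ B, x ≠ 0 := by
    rintro x ⟨-, hx⟩ rfl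
    simp at hx
  have hBΦ : ∀ x ∈ B, Φ x ≠ 0 := fun x hx => hΦ x hx.1 (hB0 x hx)
  have hnorm : ∀ x ∈ M, x ≠ 0 → (ψ x)⁻¹ • x ∈ B := by
    intro x hx h0
    have := hψ x hx h0
    refine ⟨hsmul _ (by positivity) x hx, ?_⟩
    simp [this.ne']
  let X := (fun t : T => affineChart Φ t.1) '' univ
  have hBT : ∀ b : B, Projectivization.mk ℂ b.1 (hB0 _ b.2) ∈ T :=
    fun b => (hT _ _).2 ⟨1, one_ne_zero, by rw [one_smul]; exact b.2.1⟩
  let p : B → X := fun b => ⟨(Φ b.1)⁻¹ • b.1, ⟨⟨_, hBT b⟩, trivial, rfl⟩⟩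
  have hp : Continuous p := by
    refine Continuous.subtype_mk ?_ _
    have h1 : Continuous fun b : B => Φ b.1 := Φ.continuous.comp continuous_subtype_val
    exact (h1.inv₀ fun b => hBΦ _ b.2).smul continuous_subtype_val
  have hlift : ∀ t ∈ T, ∃ b : B, Projectivization.mk ℂ b.1 (hB0 _ b.2) = t := by
    intro t ht
    have hr := t.rep_nonzero
    have ht' := ht
    rw [← t.mk_rep, hT] at ht'
    obtain ⟨l, hl0, hl⟩ := ht'
    refine ⟨⟨_, hnorm _ hl (smul_ne_zero hl0 hr)⟩, ?_⟩
    conv_rhs => rw [← t.mk_rep]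
    exact (Projectivization.mk_eq_mk_iff' ℂ _ _ _ _).2
      ⟨((ψ (l • t.rep))⁻¹ : ℝ) • l, by rw [smul_assoc]⟩
  have hsurj : Function.Surjective p := by
    rintro ⟨_, ⟨⟨t, ht⟩, -, rfl⟩⟩
    obtain ⟨b, rfl⟩ := hlift t ht
    exact ⟨b, rfl⟩
  have hfib : ∀ x, Convex ℝ (Subtype.val '' (p ⁻¹' {x})) := by
    rintro x _ ⟨b, hb, rfl⟩ _ ⟨c, hc, rfl⟩ s t hs ht hst
    have hd := hBconv b.2 c.2 hs ht hst
    refine ⟨⟨_, hd⟩, Subtype.ext ?_, rfl⟩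
    have hb' : b.1 = Φ b.1 • x.1 := by
      have : p b = x := hb
      rw [← this, smul_smul, mul_inv_cancel₀ (hBΦ _ b.2), one_smul]
    have hc' : c.1 = Φ c.1 • x.1 := by
      have : p c = x := hc
      rw [← this, smul_smul, mul_inv_cancel₀ (hBΦ _ c.2), one_smul]
    have hx1 : Φ x.1 = 1 := by
      have := congrArg Φ hb'
      rw [map_smul, smul_eq_mul] at this
      exact (mul_right_eq_self₀.1 this.symm).resolve_right (hBΦ _ b.2)
    have hd' : s • b.1 + t • c.1 = (s • Φ b.1 + t • Φ c.1) • x.1 := by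
      conv_lhs => rw [hb', hc']
      rw [add_smul, smul_assoc, smul_assoc]
    change (Φ (s • b.1 + t • c.1))⁻¹ • (s • b.1 + t • c.1) = x.1
    have hne := hBΦ _ hd
    rw [hd', map_smul, hx1, smul_eq_mul, mul_one] at hne ⊢
    rw [smul_smul, inv_mul_cancel₀ hne, one_smul]
  have hBne : B.Nonempty := by
    obtain ⟨t, ht⟩ := hne
    obtain ⟨b, -⟩ := hlift t ht
    exact ⟨_, b.2⟩
  have : ContractibleSpace X := contractibleSpace_of_convex_fibers hB hBconv hBne p hp hsurj hfib
  have hX : ∀ x : X, ∃ h : x.1 ≠ 0, Projectivization.mk ℂ x.1 h ∈ T := by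
    rintro ⟨_, ⟨⟨t, ht⟩, -, rfl⟩⟩
    obtain ⟨h0, h1⟩ := mk_affineChart Φ (hTΦ t ht)
    exact ⟨h0, h1.symm ▸ ht⟩
  refine contractibleSpace_of_retract (Y := X)
    ⟨fun t => ⟨affineChart Φ t.1, ⟨t, trivial, rfl⟩⟩,
      (continuous_affineChart_comp Φ hTΦ).subtype_mk _⟩
    ⟨fun x => ⟨Projectivization.mk ℂ x.1 (hX x).1, (hX x).2⟩,
      (continuous_mk continuous_subtype_val fun x => (hX x).1).subtype_mk _⟩ ?_
  rintro ⟨t, ht⟩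
  exact Subtype.ext (mk_affineChart Φ (hTΦ t ht)).2

end Lines

/-! ### Lifting a projectively convex set to a convex cone -/

section Lift

variable {U : Type*} [NormedAddCommGroup U] [NormedSpace ℝ U]

/-- All nonnegative combinations of `v` and `w` belong to `N`. -/
def SegmentIn (N : Set U) (v w : U) : Prop :=
  ∀ a b : ℝ, 0 ≤ a → 0 ≤ b → a • v + b • w ∈ N

/-- A closed set of vectors, stable under scalars, that is the cone over a convex subset of a
projective space. -/
structure IsProjConvex (N : Set U) : Prop where
  isClosed : IsClosed N
  smul_mem : ∀ (c : ℝ) (v : U), v ∈ N → c • v ∈ N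
  segment : ∀ v ∈ N, ∀ w ∈ N, SegmentIn N v w ∨ SegmentIn N v (-w)
  no_line : ∀ v w : U, v ≠ 0 → (∀ c : ℝ, w ≠ c • v) → ¬ ∀ a b : ℝ, a • v + b • w ∈ N

variable {N : Set U}

theorem SegmentIn.left {v w : U} (h : SegmentIn N v w) : v ∈ N := by
  simpa using h 1 0 zero_le_one le_rfl

theorem SegmentIn.right {v w : U} (h : SegmentIn N v w) : w ∈ N := by
  simpa using h 0 1 le_rfl zero_le_one

theorem SegmentIn.symm {v w : U} (h : SegmentIn N v w) : SegmentIn N w v :=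
  fun a b ha hb => by rw [add_comm]; exact h b a hb ha

namespace IsProjConvex

variable (hN : IsProjConvex N)

include hN

theorem neg_mem {v : U} (h : v ∈ N) : -v ∈ N := by
  simpa using hN.smul_mem (-1) v h

/-- The two segments joining `[v]` and `[w]` together make up the whole projective line, which
`no_line` forbids. -/
theorem not_both {v w : U} (hv : v ≠ 0) (hw : ∀ c : ℝ, w ≠ c • v) (h : SegmentIn N v w)
    (h' : SegmentIn N v (-w)) : False := by
  have key : ∀ a b : ℝ, 0 ≤ a → a • v + b • w ∈ N := by
    intro a b ha
    rcases le_total 0 b with hb | hb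
    · exact h a b ha hb
    · simpa using h' a (-b) ha (by linarith)
  refine hN.no_line v w hv hw fun a b => ?_
  rcases le_total 0 a with ha | ha
  · exact key a b ha
  · have := hN.neg_mem (key (-a) (-b) (by linarith))
    rwa [show -(-a • v + -b • w) = a • v + b • w by module] at this

theorem isClosed_segmentIn {f : ℝ → U} (hf : Continuous f) (w : U) :
    IsClosed {s | SegmentIn N w (f s)} := by
  have : {s | SegmentIn N w (f s)} =
      ⋂ (a : ℝ) (b : ℝ) (_ : 0 ≤ a) (_ : 0 ≤ b), (fun s => a • w + b • f s) ⁻¹' N := by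
    ext s; simp [SegmentIn]
  rw [this]
  exact isClosed_iInter fun a => isClosed_iInter fun b => isClosed_iInter fun _ =>
    isClosed_iInter fun _ => hN.isClosed.preimage (by fun_prop)

/-- Coherence of the sign choices. Otherwise `w` is joined to `-x`. Move `y s` from `-x` to `-v`
inside `N`: at the start `w` is joined to `y s`, at the end to `-y s`. Both conditions are closed
and together cover `[0, 1]`, so both hold at some `s`, which by `not_both` forces `y s` to be a
multiple of `w`. -/
theorem segmentIn_of_common {v w x : U} (hv : v ≠ 0) (hw : ∀ c : ℝ, w ≠ c • v)
    (hx : ∀ c : ℝ, x ≠ c • v) (hvw : SegmentIn N v w) (hvx : SegmentIn N v x) :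
    SegmentIn N w x := by
  by_contra h
  have h' := (hN.segment w hvw.right x hvx.right).resolve_left h
  have hw0 : w ≠ 0 := by simpa using hw 0
  let y : ℝ → U := fun s => (s - 1) • x - s • v
  have hy : Continuous y := by fun_prop
  have hyN : ∀ s ∈ Icc (0 : ℝ) 1, y s ∈ N := by
    intro s hs
    have := hN.neg_mem (hvx s (1 - s) hs.1 (by linarith [hs.2]))
    rwa [show -(s • v + (1 - s) • x) = y s by simp only [y]; module] at this
  obtain ⟨s, ⟨hs0, hs1⟩, h1, h2⟩ := isPreconnected_closed_iff.1
    (isPreconnected_Icc (a := (0 : ℝ)) (b := 1)) _ _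
    (hN.isClosed_segmentIn hy w) (hN.isClosed_segmentIn hy.neg w)
    (fun s hs => hN.segment w hvw.right _ (hyN s hs))
    ⟨0, by simp, by simpa [y] using h'⟩ ⟨1, by simp, by simpa [y] using hvw.symm⟩
  by_cases hdep : ∀ c : ℝ, y s ≠ c • w
  · exact hN.not_both hw0 hdep h1 h2
  push Not at hdep
  obtain ⟨c, hc⟩ := hdep
  simp only [y] at hc
  -- For `c < 0`, `w` is a nonnegative combination of `x` and `v`, so `w` is joined to `x` after
  -- all. For `c = 0`, `v` vanishes or `x` is a multiple of it. For `c > 0`, either `w` is a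
  -- multiple of `v`, or `-x` is a nonnegative combination of `v` and `w`, so that `v` is joined to
  -- both `x` and `-x`.
  rcases lt_trichotomy c 0 with hc0 | rfl | hc0
  · refine h fun a b ha hb => ?_
    have hw' : w = ((1 - s) * (-c)⁻¹) • x + (s * (-c)⁻¹) • v := by
      have h3 : (-c) • w = (1 - s) • x + s • v := by
        rw [neg_smul, ← hc]; module
      have h4 : w = (-c)⁻¹ • ((-c) • w) := by
        rw [smul_smul, inv_mul_cancel₀ (by linarith), one_smul]
      rw [h4, h3]; module
    have hi : 0 ≤ (-c)⁻¹ := inv_nonneg.2 (by linarith)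
    have := hvx (a * (s * (-c)⁻¹)) (a * ((1 - s) * (-c)⁻¹) + b) (by positivity)
      (add_nonneg (mul_nonneg ha (mul_nonneg (by linarith) hi)) hb)
    rw [hw']
    convert this using 1
    module
  · rcases hs1.eq_or_lt with rfl | hs1
    · apply hv
      simpa using hc
    · refine hx (-(s * (1 - s)⁻¹)) ?_
      have h3 : (1 - s) • x = (-s) • v := by
        have : (1 - s) • x + s • v = 0 := by
          rw [zero_smul] at hc
          rw [← neg_zero, ← hc]; module
        rw [eq_neg_of_add_eq_zero_left this, neg_smul]
      have h4 : x = (1 - s)⁻¹ • ((1 - s) • x) := by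
        rw [smul_smul, inv_mul_cancel₀ (by linarith), one_smul]
      rw [h4, h3]; module
  · rcases hs1.eq_or_lt with rfl | hs1
    · refine hw (-c⁻¹) ?_
      have h4 : w = c⁻¹ • (c • w) := by rw [smul_smul, inv_mul_cancel₀ hc0.ne', one_smul]
      rw [h4, ← hc]; module
    · refine hN.not_both hv hx hvx fun a b ha hb => ?_
      have hi : 0 < (1 - s)⁻¹ := inv_pos.2 (by linarith)
      have h4 : -x = ((1 - s)⁻¹ * s) • v + ((1 - s)⁻¹ * c) • w := by
        have : -x = (1 - s)⁻¹ • ((1 - s) • -x) := by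
          rw [smul_smul, inv_mul_cancel₀ (by linarith), one_smul]
        rw [this, show (1 - s) • -x = ((s - 1) • x - s • v) + s • v by module, hc]; module
      have := hvw (a + b * ((1 - s)⁻¹ * s)) (b * ((1 - s)⁻¹ * c)) (by positivity) (by positivity)
      rw [h4]
      convert this using 1
      module

/-- One of the two opposite convex cones whose union is `N \ {0}`: the one containing `v₀`. -/
def lift {v₀ : U} (hv₀ : v₀ ≠ 0) : ConvexCone ℝ U where
  carrier := {w | (∃ c : ℝ, 0 < c ∧ w = c • v₀) ∨ ((∀ c : ℝ, w ≠ c • v₀) ∧ SegmentIn N v₀ w)}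
  smul_mem' := by
    rintro c hc w (⟨d, hd, rfl⟩ | ⟨hw, h⟩)
    · exact Or.inl ⟨c * d, mul_pos hc hd, by rw [smul_smul]⟩
    · refine Or.inr ⟨fun d hd => hw (c⁻¹ * d) ?_, fun a b ha hb => ?_⟩
      · rw [mul_smul, ← hd, smul_smul, inv_mul_cancel₀ hc.ne', one_smul]
      · rw [smul_smul]; exact h _ _ ha (by positivity)
  add_mem' := by
    have mixed : ∀ c : ℝ, 0 < c → ∀ x : U, (∀ c : ℝ, x ≠ c • v₀) → SegmentIn N v₀ x →
        (∀ d : ℝ, c • v₀ + x ≠ d • v₀) ∧ SegmentIn N v₀ (c • v₀ + x) := by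
      intro c hc x hx h
      refine ⟨fun d hd => hx (d - c) ?_, fun a b ha hb => ?_⟩
      · rw [sub_smul, ← hd, add_sub_cancel_left]
      · have := h (a + b * c) b (by positivity) hb
        convert this using 1
        module
    rintro w (⟨c, hc, rfl⟩ | ⟨hw, hvw⟩) x (⟨d, hd, rfl⟩ | ⟨hx, hvx⟩)
    · exact Or.inl ⟨c + d, add_pos hc hd, by rw [add_smul]⟩
    · exact Or.inr (mixed c hc x hx hvx)
    · rw [add_comm]
      exact Or.inr (mixed d hd w hw hvw)
    · by_cases hy : ∀ c : ℝ, w + x ≠ c • v₀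
      · refine Or.inr ⟨hy, ?_⟩
        have hwx := hN.segmentIn_of_common hv₀ hw hx hvw hvx
        have hx0 : x ≠ 0 := by simpa using hx 0
        by_cases hpar : ∃ c : ℝ, w = c • x
        · obtain ⟨c, rfl⟩ := hpar
          rcases lt_or_ge c 0 with hc | hc
          · refine (hN.not_both hv₀ hx hvx fun a b ha hb => ?_).elim
            have := hvw a (b * (-c)⁻¹) ha (mul_nonneg hb (inv_nonneg.2 (by linarith)))
            convert this using 2
            rw [smul_smul, mul_assoc, inv_neg, neg_mul, inv_mul_cancel₀ hc.ne]
            module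
          · intro a b ha hb
            have := hvx a (b * (c + 1)) ha (by positivity)
            convert this using 1
            module
        · push Not at hpar
          -- Coherence is now used with `x` as the common vertex: `x` is joined to `w + x` and to
          -- `v₀`.
          refine (hN.segmentIn_of_common hx0 (w := w + x) (x := v₀) (fun c hc => ?_)
            (fun c hc => ?_) (fun a b ha hb => ?_) hvx.symm).symm
          · exact hpar (c - 1) (by rw [sub_smul, ← hc]; module)
          · have hc0 : c ≠ 0 := by
              rintro rfl
              exact hv₀ (by simpa using hc)
            exact hx c⁻¹ (by rw [hc, smul_smul, inv_mul_cancel₀ hc0, one_smul])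
          · have := hwx b (a + b) hb (by positivity)
            convert this using 1
            module
      · push Not at hy
        obtain ⟨c, hc⟩ := hy
        refine Or.inl ⟨c, ?_, hc⟩
        by_contra hneg
        push Not at hneg
        -- If `c ≤ 0`, then `-w = x - c • v₀` is a nonnegative combination of `x` and `v₀`, so `v₀`
        -- would be joined to `-w` too.
        refine hN.not_both hv₀ hw hvw fun a b ha hb => ?_
        have hw' : -w = x - c • v₀ := by rw [← hc]; module
        have := hvx (a + b * (-c)) b (add_nonneg ha (mul_nonneg hb (by linarith))) hb
        rw [hw']
        convert this using 1
        module

theorem mem_lift {v₀ : U} (hv₀ : v₀ ≠ 0) {w : U} : w ∈ hN.lift hv₀ ↔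
    (∃ c : ℝ, 0 < c ∧ w = c • v₀) ∨ ((∀ c : ℝ, w ≠ c • v₀) ∧ SegmentIn N v₀ w) := Iff.rfl

theorem neg_notMem_lift {v₀ : U} (hv₀ : v₀ ≠ 0) {w : U} (hw : w ∈ hN.lift hv₀) :
    -w ∉ hN.lift hv₀ := by
  rw [mem_lift] at hw ⊢
  rcases hw with ⟨c, hc, rfl⟩ | ⟨hw, h⟩
  · rintro (⟨d, hd, h⟩ | ⟨h, -⟩)
    · have : (c + d) • v₀ = 0 := by rw [add_smul, ← h, add_neg_cancel]
      rcases smul_eq_zero.1 this with h | h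
      · linarith
      · exact hv₀ h
    · exact h (-c) (by rw [neg_smul])
  · rintro (⟨d, hd, h'⟩ | ⟨-, h'⟩)
    · exact hw (-d) (by rw [neg_smul, ← h', neg_neg])
    · exact hN.not_both hv₀ hw h h'

theorem mem_iff_lift {v₀ : U} (hv₀ : v₀ ≠ 0) (h₀ : v₀ ∈ N) {w : U} (hw0 : w ≠ 0) :
    w ∈ N ↔ w ∈ hN.lift hv₀ ∨ -w ∈ hN.lift hv₀ := by
  have sub : ∀ w, w ∈ hN.lift hv₀ → w ∈ N := by
    rintro w (⟨c, hc, rfl⟩ | ⟨-, h⟩)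
    · exact hN.smul_mem c _ h₀
    · exact h.right
  refine ⟨fun hw => ?_, fun h => h.elim (sub w) fun h => by simpa using hN.neg_mem (sub _ h)⟩
  by_cases hpar : ∃ c : ℝ, w = c • v₀
  · obtain ⟨c, rfl⟩ := hpar
    rcases lt_trichotomy c 0 with hc | rfl | hc
    · exact Or.inr (Or.inl ⟨-c, by linarith, by rw [neg_smul]⟩)
    · simp at hw0
    · exact Or.inl (Or.inl ⟨c, hc, rfl⟩)
  · push Not at hpar
    refine (hN.segment v₀ h₀ w hw).imp (fun h => Or.inr ⟨hpar, h⟩) fun h => Or.inr ⟨fun c hc => ?_, h⟩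
    exact hpar (-c) (by rw [neg_smul, ← hc, neg_neg])

/-- A nonzero limit `w` of the cone outside it lies in `N`, so `-w` is in the cone. If some `e` in
the cone is independent of `w`, then `e + c • w ∈ N` for every real `c`, for `c < 0` by convexity
and for `c > 0` by passing to the limit, and `N` contains a plane. If there is none, the cone lies
on the ray of `-w`, away from `w`. -/
theorem isClosed_insert_lift {v₀ : U} (hv₀ : v₀ ≠ 0) (h₀ : v₀ ∈ N) :
    IsClosed (insert 0 (hN.lift hv₀ : Set U)) := by
  set C := hN.lift hv₀ with hC
  have hCN : ∀ w ∈ C, w ∈ N := by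
    intro w hw
    rcases eq_or_ne w 0 with rfl | h0
    · simpa using hN.smul_mem 0 _ h₀
    · exact (hN.mem_iff_lift hv₀ h₀ h0).2 (Or.inl hw)
  have hclN : closure (C : Set U) ⊆ N := closure_minimal hCN hN.isClosed
  refine isClosed_of_closure_subset fun w hw => ?_
  rw [insert_eq, closure_union, closure_singleton] at hw
  by_contra hwC
  rw [mem_insert_iff, not_or] at hwC
  replace hw : w ∈ closure (C : Set U) := hw.resolve_left hwC.1
  have hu : -w ∈ C := ((hN.mem_iff_lift hv₀ h₀ hwC.1).1 (hclN hw)).resolve_left hwC.2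
  have hsalient : ∀ c : ℝ, c < 0 → c • -w ∉ C := by
    intro c hc h
    have h1 := C.smul_mem (inv_pos.2 (neg_pos.2 hc)) h
    rw [smul_smul, inv_neg, neg_mul, inv_mul_cancel₀ hc.ne, neg_one_smul] at h1
    exact hN.neg_notMem_lift hv₀ hu h1
  by_cases hpar : ∀ e ∈ C, ∃ c : ℝ, e = c • -w
  · obtain ⟨f, -, hf⟩ := exists_dual_vector ℝ w (norm_ne_zero_iff.2 hwC.1)
    have hfw : 0 < f w := by rw [hf]; simpa using hwC.1
    have : closure (C : Set U) ⊆ {x | f x ≤ 0} := by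
      refine closure_minimal (fun e he => ?_) (isClosed_le f.continuous continuous_const)
      obtain ⟨c, rfl⟩ := hpar e he
      rcases lt_or_ge c 0 with hc | hc
      · exact (hsalient c hc he).elim
      · simpa using mul_nonneg hc hfw.le
    exact absurd (this hw) (not_le.2 hfw)
  · push Not at hpar
    obtain ⟨e, he, hpar⟩ := hpar
    have hadd : ∀ c : ℝ, e + c • w ∈ N := by
      intro c
      rcases lt_trichotomy c 0 with hc | rfl | hc
      · have := hCN _ (C.add_mem he (C.smul_mem (neg_pos.2 hc) hu))
        simpa using this
      · simpa using hCN e he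
      · refine hclN ?_
        refine map_mem_closure (f := fun x => e + c • x) (by fun_prop) hw fun x hx => ?_
        exact C.add_mem he (C.smul_mem hc hx)
    refine hN.no_line w e hwC.1 (fun c hc => hpar (-c) (by rw [hc]; module)) fun a b => ?_
    rcases eq_or_ne b 0 with rfl | hb
    · simpa using hN.smul_mem a _ (hclN hw)
    · have := hN.smul_mem b _ (hadd (b⁻¹ * a))
      rwa [smul_add, smul_smul, mul_inv_cancel_left₀ hb, add_comm] at this

end IsProjConvex

end Lift

/-! ### From compact convex sets to cones -/

section Projective

variable {U : Type*} [NormedAddCommGroup U] [NormedSpace ℝ U]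

/-- The vectors representing a point of `D`, together with zero. -/
def coneOver (D : Set (ℙ ℝ U)) : Set U :=
  {v | ∀ h : v ≠ 0, Projectivization.mk ℝ v h ∈ D}

theorem isClosed_coneOver {D : Set (ℙ ℝ U)} (hD : IsClosed D) : IsClosed (coneOver D) := by
  rw [← isOpen_compl_iff]
  have h : (coneOver D)ᶜ = Subtype.val '' (Projectivization.mk' ℝ ⁻¹' Dᶜ : Set {v : U // v ≠ 0}) := by
    ext v
    simp [coneOver]
  rw [h]
  have : IsOpen {v : U | v ≠ 0} := isOpen_ne
  exact this.isOpenEmbedding_subtypeVal.isOpenMap _ (hD.isOpen_compl.preimage continuous_mk')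

theorem smul_mem_coneOver {D : Set (ℙ ℝ U)} (c : ℝ) {v : U} (hv : v ∈ coneOver D) :
    c • v ∈ coneOver D := by
  intro h
  have hv0 : v ≠ 0 := right_ne_zero_of_smul h
  have e : Projectivization.mk ℝ (c • v) h = Projectivization.mk ℝ v hv0 :=
    (Projectivization.mk_eq_mk_iff' ℝ _ _ _ _).2 ⟨c, rfl⟩
  rw [e]
  exact hv hv0

theorem finrank_span_pair {v w : U} (hv : v ≠ 0) (hw : ∀ c : ℝ, w ≠ c • v) :
    LinearIndependent ℝ ![v, w] ∧ Module.finrank ℝ (Submodule.span ℝ {v, w}) = 2 := by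
  have h : LinearIndependent ℝ ![v, w] :=
    (LinearIndependent.pair_iff' hv).2 fun c hc => hw c hc.symm
  refine ⟨h, ?_⟩
  have := finrank_span_eq_card h
  rwa [Matrix.range_cons_cons_empty, Fintype.card_fin] at this

theorem exists_coordinates [FiniteDimensional ℝ U] {v w : U} (h : LinearIndependent ℝ ![v, w]) :
    ∃ A B : StrongDual ℝ U, A v = 1 ∧ A w = 0 ∧ B v = 0 ∧ B w = 1 := by
  let g : ℝ × ℝ →ₗ[ℝ] U := (LinearMap.toSpanSingleton ℝ U v).coprod (LinearMap.toSpanSingleton ℝ U w)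
  have hg : LinearMap.ker g = ⊥ := by
    rw [LinearMap.ker_eq_bot']
    rintro ⟨a, b⟩ hab
    have := LinearIndependent.pair_iff.1 h a b (by simpa [g] using hab)
    simp [this.1, this.2]
  obtain ⟨k, hk⟩ := g.exists_leftInverse_of_injective hg
  have h1 : k v = (1, 0) := by
    have := LinearMap.congr_fun hk (1, 0)
    simpa [g] using this
  have h2 : k w = (0, 1) := by
    have := LinearMap.congr_fun hk (0, 1)
    simpa [g] using this
  exact ⟨(LinearMap.fst ℝ ℝ ℝ ∘ₗ k).toContinuousLinearMap,
    (LinearMap.snd ℝ ℝ ℝ ∘ₗ k).toContinuousLinearMap, by simp [h1], by simp [h2], by simp [h1],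
    by simp [h2]⟩

/-- If each of the two segments misses a point of `D`, say `[a v + b w]` and `[a' v - b' w]`, then
the quadratic form `q` vanishing on the line exactly at these two points has a sign on projective
points. It is positive at `v` and negative at `w`, so it disconnects the section of `D`. -/
theorem segmentIn_coneOver [FiniteDimensional ℝ U] {D : Set (ℙ ℝ U)} (hconv : IsConvex D) {v w : U}
    (hv : v ∈ coneOver D) (hw : w ∈ coneOver D) :
    SegmentIn (coneOver D) v w ∨ SegmentIn (coneOver D) v (-w) := by
  rcases eq_or_ne v 0 with rfl | hv0
  · refine Or.inl fun a b _ _ => ?_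
    simpa using smul_mem_coneOver b hw
  by_cases hpar : ∃ c : ℝ, w = c • v
  · obtain ⟨c, rfl⟩ := hpar
    refine Or.inl fun a b _ _ => ?_
    rw [smul_smul, ← add_smul]
    exact smul_mem_coneOver _ hv
  push Not at hpar
  obtain ⟨hli, hrank⟩ := finrank_span_pair hv0 hpar
  have hw0 : w ≠ 0 := by simpa using hpar 0
  obtain ⟨A, B, hAv, hAw, hBv, hBw⟩ := exists_coordinates hli
  by_contra hcon
  simp only [SegmentIn, not_or, not_forall] at hcon
  obtain ⟨⟨a, b, ha, hb, hab⟩, ⟨a', b', ha', hb', hab'⟩⟩ := hcon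
  have hapos : 0 < a := ha.lt_of_ne (by
    rintro rfl
    exact hab (by simpa using smul_mem_coneOver b hw))
  have hbpos : 0 < b := hb.lt_of_ne (by
    rintro rfl
    exact hab (by simpa using smul_mem_coneOver a hv))
  have hapos' : 0 < a' := ha'.lt_of_ne (by
    rintro rfl
    exact hab' (by simpa using smul_mem_coneOver (-b') hw))
  have hbpos' : 0 < b' := hb'.lt_of_ne (by
    rintro rfl
    exact hab' (by simpa using smul_mem_coneOver a' hv))
  let q : U → ℝ := fun x => (b * A x - a * B x) * (b' * A x + a' * B x)
  have hq : Continuous q := by fun_prop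
  have hqs : ∀ (c : ℝ) x, q (c • x) = c ^ 2 * q x := by
    intro c x
    simp only [q, map_smul, smul_eq_mul]; ring
  have hopen : ∀ s : Set U, IsOpen s →
      IsOpen (Projectivization.mk' ℝ '' (Subtype.val ⁻¹' s : Set {v : U // v ≠ 0})) :=
    fun s hs => isOpenQuotientMap_mk'.isOpenMap _ (hs.preimage continuous_subtype_val)
  obtain ⟨x, -, ⟨⟨y, hy0⟩, hy, rfl⟩, ⟨⟨z, hz0⟩, hz, hzy⟩⟩ := (hconv _ hrank).2 _ _
    (hopen _ (isOpen_lt continuous_const hq : IsOpen {x | 0 < q x}))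
    (hopen _ (isOpen_lt hq continuous_const : IsOpen {x | q x < 0})) (by
      rintro x ⟨hxD, hxW⟩
      induction x with | h z hz => ?_
      have hzW : z ∈ Submodule.span ℝ {v, w} := hxW
      obtain ⟨r, s, rfl⟩ := Submodule.mem_span_pair.1 hzW
      have hzN : r • v + s • w ∈ coneOver D := fun _ => hxD
      have hqz : q (r • v + s • w) = (b * r - a * s) * (b' * r + a' * s) := by
        simp [q, hAv, hAw, hBv, hBw]
      have hq0 : q (r • v + s • w) ≠ 0 := by
        rw [hqz]
        refine mul_ne_zero (fun h0 => ?_) (fun h0 => ?_)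
        · have hs : s ≠ 0 := by
            rintro rfl
            have : r = 0 := by simpa [hbpos.ne'] using h0
            exact hz (by simp [this])
          refine hab ?_
          have := smul_mem_coneOver (b * s⁻¹) hzN
          rw [smul_add, smul_smul, smul_smul, show b * s⁻¹ * r = a by field_simp; linarith,
            show b * s⁻¹ * s = b by field_simp] at this
          exact this
        · have hs : s ≠ 0 := by
            rintro rfl
            have : r = 0 := by simpa [hbpos'.ne'] using h0
            exact hz (by simp [this])
          refine hab' ?_
          have := smul_mem_coneOver (-b' * s⁻¹) hzN
          rw [smul_add, smul_smul, smul_smul, show -b' * s⁻¹ * r = a' by field_simp; linarith,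
            show -b' * s⁻¹ * s = -b' by field_simp, neg_smul, ← smul_neg] at this
          exact this
      rcases hq0.lt_or_gt with h | h
      · exact Or.inr ⟨⟨_, hz⟩, h, rfl⟩
      · exact Or.inl ⟨⟨_, hz⟩, h, rfl⟩)
    ⟨Projectivization.mk ℝ v hv0, ⟨hv hv0, Submodule.subset_span (by simp)⟩, ⟨v, hv0⟩, by
      change 0 < q v
      simp only [q, hAv, hBv]
      ring_nf
      positivity, rfl⟩
    ⟨Projectivization.mk ℝ w hw0, ⟨hw hw0, Submodule.subset_span (by simp)⟩, ⟨w, hw0⟩, by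
      change q w < 0
      simp only [q, hAw, hBw]
      nlinarith [mul_pos hapos hapos'], rfl⟩
  obtain ⟨c, rfl⟩ := (Projectivization.mk_eq_mk_iff' ℝ z y hz0 hy0).1 hzy
  have h1 : 0 < q y := hy
  have h2 : q (c • y) < 0 := hz
  rw [hqs] at h2
  nlinarith [sq_nonneg c, mul_nonneg (sq_nonneg c) h1.le]

theorem isProjConvex_coneOver [FiniteDimensional ℝ U] {D : Set (ℙ ℝ U)} (hcomp : IsCompact D)
    (hconv : IsConvex D) : IsProjConvex (coneOver D) where
  isClosed := by
    have := t2Space_projectivization (V := U)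
    exact isClosed_coneOver hcomp.isClosed
  smul_mem c _ hv := smul_mem_coneOver c hv
  segment _ hv _ hw := segmentIn_coneOver hconv hv hw
  no_line v w hv hw h := by
    refine (hconv _ (finrank_span_pair hv hw).2).1 fun x hx => ?_
    induction x with | h z hz => ?_
    have hzW : z ∈ Submodule.span ℝ {v, w} := hx
    obtain ⟨r, s, rfl⟩ := Submodule.mem_span_pair.1 hzW
    exact h r s hz

/-- A compact convex set in a projective space is the set of points of a closed salient convex
cone. -/
theorem exists_cone [FiniteDimensional ℝ U] {D : Set (ℙ ℝ U)} (hcomp : IsCompact D)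
    (hconv : IsConvex D) (hne : D.Nonempty) : ∃ C : ConvexCone ℝ U,
      (∀ v ∈ C, -v ∉ C) ∧ IsClosed (insert 0 (C : Set U)) ∧ (C : Set U).Nonempty ∧
      ∀ v hv, Projectivization.mk ℝ v hv ∈ D ↔ v ∈ C ∨ -v ∈ C := by
  have hN := isProjConvex_coneOver hcomp hconv
  obtain ⟨x, hx⟩ := hne
  induction x with | h v₀ hv₀ => ?_
  have h₀ : v₀ ∈ coneOver D := fun _ => hx
  refine ⟨hN.lift hv₀, fun v hv => hN.neg_notMem_lift hv₀ hv, hN.isClosed_insert_lift hv₀ h₀,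
    ⟨v₀, Or.inl ⟨1, one_pos, by simp⟩⟩, fun v hv => ?_⟩
  rw [← hN.mem_iff_lift hv₀ h₀ hv]
  exact ⟨fun h _ => h, fun h => h hv⟩

end Projective

/-! ### The open dual cone and the bipolar theorem -/

section Cones

variable {U : Type*} [NormedAddCommGroup U] [NormedSpace ℝ U]

/-- The open dual cone of `C`. -/
def posDual (C : ConvexCone ℝ U) : ConvexCone ℝ (StrongDual ℝ U) where
  carrier := {ξ | ∀ v ∈ C, 0 < ξ v}
  smul_mem' _ hc _ hξ v hv := mul_pos hc (hξ v hv)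
  add_mem' _ hξ _ hη v hv := add_pos (hξ v hv) (hη v hv)

theorem zero_notMem_of_salient {C : ConvexCone ℝ U} (hC : ∀ v ∈ C, -v ∉ C) : (0 : U) ∉ C :=
  fun h => hC 0 h (by simpa using h)

theorem normalize_mem {C : ConvexCone ℝ U} {v : U} (hv : v ∈ C) (h0 : v ≠ 0) :
    ‖v‖⁻¹ • v ∈ (C : Set U) ∩ Metric.sphere 0 1 := by
  have h : 0 < ‖v‖ := norm_pos_iff.2 h0
  exact ⟨C.smul_mem (inv_pos.2 h) hv, by simp [norm_smul, h.ne']⟩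

theorem exists_nonneg_functional {C : ConvexCone ℝ U} (hcl : IsClosed (insert 0 (C : Set U)))
    {a : U} (ha : a ∉ insert 0 (C : Set U)) :
    ∃ f : StrongDual ℝ U, (∀ v ∈ C, 0 ≤ f v) ∧ f a < 0 := by
  have hconv : Convex ℝ (insert 0 (C : Set U)) := by
    refine convex_iff_forall_pos.2 fun x hx y hy s t hs ht _ => ?_
    rcases hx with rfl | hx <;> rcases hy with rfl | hy
    · left; simp
    · right; simpa using C.smul_mem ht hy
    · right; simpa using C.smul_mem hs hx
    · right; exact C.add_mem (C.smul_mem hs hx) (C.smul_mem ht hy)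
  obtain ⟨f, u, hu, hf⟩ := geometric_hahn_banach_point_closed hconv hcl ha
  have hu0 : u < 0 := by simpa using hf 0 (Or.inl rfl)
  refine ⟨f, fun v hv => ?_, hu.trans hu0⟩
  by_contra hneg
  push Not at hneg
  -- Rescaling `v` by `u / f v > 0` makes `f` equal to `u`, against the strict separation.
  have := hf _ (Or.inr (C.smul_mem (div_pos_of_neg_of_neg hu0 hneg) hv))
  rw [map_smul, smul_eq_mul, div_mul_cancel₀ _ hneg.ne] at this
  exact lt_irrefl _ this

variable [FiniteDimensional ℝ U]

theorem isCompact_inter_sphere {C : ConvexCone ℝ U} (hcl : IsClosed (insert 0 (C : Set U))) :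
    IsCompact ((C : Set U) ∩ Metric.sphere 0 1) := by
  have : (C : Set U) ∩ Metric.sphere 0 1 = insert 0 (C : Set U) ∩ Metric.sphere 0 1 := by
    ext v
    constructor
    · exact fun h => ⟨Or.inr h.1, h.2⟩
    · rintro ⟨rfl | h, h'⟩
      · simp at h'
      · exact ⟨h, h'⟩
  rw [this]
  exact (isCompact_sphere 0 1).inter_left hcl

/-- Separating `-v` from the closed cone gives a functional nonnegative on `C` and positive near
`v`; by compactness of the unit vectors of `C`, a finite sum of these is positive on all of `C`. -/
theorem posDual_nonempty {C : ConvexCone ℝ U} (hC : ∀ v ∈ C, -v ∉ C)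
    (hcl : IsClosed (insert 0 (C : Set U))) : ∃ φ, φ ∈ posDual C := by
  have h0 := zero_notMem_of_salient hC
  obtain ⟨f, -, hf⟩ := (isCompact_inter_sphere hcl).induction_on
    (p := fun s => ∃ f : StrongDual ℝ U, (∀ v ∈ C, 0 ≤ f v) ∧ ∀ v ∈ s, v ∈ C → 0 < f v)
    ⟨0, by simp, by simp⟩
    (fun s t hst ⟨f, hf, hf'⟩ => ⟨f, hf, fun v hv => hf' v (hst hv)⟩)
    (fun s t ⟨f, hf, hf'⟩ ⟨g, hg, hg'⟩ => ⟨f + g, fun v hv => add_nonneg (hf v hv) (hg v hv), by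
      rintro v (hv | hv) hvC
      · exact add_pos_of_pos_of_nonneg (hf' v hv hvC) (hg v hvC)
      · exact add_pos_of_nonneg_of_pos (hf v hvC) (hg' v hv hvC)⟩)
    (fun v hv => by
      obtain ⟨f, hf, hfv⟩ := exists_nonneg_functional hcl (a := -v) (by
        rintro (h | h)
        · exact h0 (neg_eq_zero.1 h ▸ hv.1)
        · exact hC v hv.1 h)
      have : 0 < f v := by simpa using hfv
      exact ⟨{x | 0 < f x}, mem_nhdsWithin_of_mem_nhds
        ((isOpen_lt continuous_const f.continuous).mem_nhds this), f, hf, fun x hx _ => hx⟩)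
  refine ⟨f, fun v hv => ?_⟩
  have hw := normalize_mem hv fun h => h0 (h ▸ hv)
  have h := hf _ hw hw.1
  rw [map_smul, smul_eq_mul] at h
  exact pos_of_mul_pos_right h (by positivity)

/-- The ball about `ξ` whose radius is the minimum of `ξ` on the unit vectors of `C` stays in the
dual cone. -/
theorem isOpen_posDual {C : ConvexCone ℝ U} (hC : ∀ v ∈ C, -v ∉ C)
    (hcl : IsClosed (insert 0 (C : Set U))) : IsOpen (posDual C : Set (StrongDual ℝ U)) := by
  have h0 := zero_notMem_of_salient hC
  have hcpt := isCompact_inter_sphere hcl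
  rcases ((C : Set U) ∩ Metric.sphere 0 1).eq_empty_or_nonempty with he | hne
  · have : (posDual C : Set (StrongDual ℝ U)) = univ := by
      refine eq_univ_of_forall fun ξ v hv => ?_
      have := normalize_mem hv fun h => h0 (h ▸ hv)
      rw [he] at this
      exact this.elim
    rw [this]
    exact isOpen_univ
  · rw [Metric.isOpen_iff]
    intro ξ hξ
    obtain ⟨m, hm, hmin⟩ := hcpt.exists_isMinOn hne ξ.continuous.continuousOn
    refine ⟨ξ m, hξ m hm.1, fun η hη v hv => ?_⟩
    have hv0 : v ≠ 0 := fun h => h0 (h ▸ hv)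
    have hw := normalize_mem hv hv0
    have h1 : ξ m ≤ ξ (‖v‖⁻¹ • v) := hmin hw
    have h2 : ‖(η - ξ) (‖v‖⁻¹ • v)‖ ≤ ‖η - ξ‖ * ‖‖v‖⁻¹ • v‖ := (η - ξ).le_opNorm _
    rw [mem_sphere_zero_iff_norm.1 hw.2, mul_one, ← dist_eq_norm, Real.norm_eq_abs] at h2
    have h3 := (abs_le.1 h2).1
    rw [sub_apply] at h3
    have h4 : dist η ξ < ξ m := hη
    have h5 : 0 < η (‖v‖⁻¹ • v) := by linarith
    rw [map_smul, smul_eq_mul] at h5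
    exact pos_of_mul_pos_right h5 (by positivity)

/-- The bipolar theorem. -/
theorem mem_of_posDual_nonneg {C : ConvexCone ℝ U} (hC : ∀ v ∈ C, -v ∉ C)
    (hcl : IsClosed (insert 0 (C : Set U))) {a : U} (ha : ∀ ξ ∈ posDual C, 0 ≤ ξ a) :
    a ∈ insert 0 (C : Set U) := by
  by_contra hmem
  obtain ⟨φ, hφ⟩ := posDual_nonempty hC hcl
  obtain ⟨f, hfC, hfa⟩ := exists_nonneg_functional hcl hmem
  have hd : 0 < |φ a| + 1 := by positivity
  have hε : 0 < -f a / (|φ a| + 1) := div_pos (by linarith) hd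
  -- A multiple of `φ` makes `f` strictly positive on `C`; the coefficient is small enough to keep
  -- the value at `a` negative.
  have hξ : f + (-f a / (|φ a| + 1)) • φ ∈ posDual C := fun v hv =>
    add_pos_of_nonneg_of_pos (hfC v hv) (mul_pos hε (hφ v hv))
  have h1 := ha _ hξ
  have h2 : (-f a / (|φ a| + 1)) * φ a < -f a := by
    rw [div_mul_eq_mul_div, div_lt_iff₀ hd]
    nlinarith [le_abs_self (φ a)]
  simp only [add_apply, smul_apply, smul_eq_mul] at h1
  linarith

end Cones

/-- A complex vector space `E` as the complexification of a real vector space `U`. -/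
structure Complexification (U E : Type*) [AddCommGroup U] [Module ℝ U] [AddCommGroup E]
    [Module ℂ E] [Module ℝ E] where
  /-- The inclusion of the real vectors. -/
  ι : U →ₗ[ℝ] E
  /-- The real part. -/
  re : E →ₗ[ℝ] U
  re_ι : ∀ v, re (ι v) = v
  re_I_smul_ι : ∀ v, re (Complex.I • ι v) = 0
  decomp : ∀ z, ι (re z) + Complex.I • ι (-re (Complex.I • z)) = z

namespace Complexification

/-! ### The tube over a cone as the classes of `C + iC` -/

section Algebra

variable {U E : Type*} [AddCommGroup U] [Module ℝ U] [AddCommGroup E] [Module ℂ E] [Module ℝ E]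
  [IsScalarTower ℝ ℂ E] (κ : Complexification U E)

/-- The imaginary part. -/
noncomputable def im : E →ₗ[ℝ] U where
  toFun z := -κ.re (Complex.I • z)
  map_add' x y := by rw [smul_add, map_add, neg_add]
  map_smul' c x := by rw [smul_comm, map_smul, smul_neg, RingHom.id_apply]

theorem im_apply (z : E) : κ.im z = -κ.re (Complex.I • z) := rfl

theorem re_add_im (z : E) : κ.ι (κ.re z) + Complex.I • κ.ι (κ.im z) = z := κ.decomp z

theorem ofReal_smul_eq (r : ℝ) (z : E) : (r : ℂ) • z = r • z :=
  algebraMap_smul ℂ r z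

theorem smul_eq (l : ℂ) (z : E) : l • z = l.re • z + l.im • (Complex.I • z) := by
  conv_lhs => rw [← Complex.re_add_im l]
  rw [add_smul, mul_smul, ofReal_smul_eq, ofReal_smul_eq]

theorem re_smul (l : ℂ) (z : E) : κ.re (l • z) = l.re • κ.re z - l.im • κ.im z := by
  rw [smul_eq, map_add, map_smul, map_smul, im_apply]
  module

theorem im_smul (l : ℂ) (z : E) : κ.im (l • z) = l.re • κ.im z + l.im • κ.re z := by
  rw [im_apply, smul_smul, re_smul]
  simp only [Complex.mul_re, Complex.mul_im, Complex.I_re, Complex.I_im]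
  module

theorem im_ι (v : U) : κ.im (κ.ι v) = 0 := by
  rw [im_apply, κ.re_I_smul_ι, neg_zero]

theorem eq_zero {z : E} (h : κ.re z = 0) (h' : κ.im z = 0) : z = 0 := by
  rw [← κ.re_add_im z, h, h']
  simp

/-- Multiplying by `conj c₀` makes `c₀` nonnegative and puts `c₁` in the right half-plane; if `c₁`
falls in the fourth quadrant, a further quarter turn brings both into the first. -/
theorem exists_rotate {c₀ c₁ : ℂ} (h : 0 ≤ (c₀ * (starRingEnd ℂ) c₁).re) :
    ∃ l : ℂ, l ≠ 0 ∧ 0 ≤ (l * c₀).re ∧ 0 ≤ (l * c₀).im ∧ 0 ≤ (l * c₁).re ∧ 0 ≤ (l * c₁).im := by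
  by_cases hc : c₀ = 0
  · by_cases hc' : c₁ = 0
    · exact ⟨1, one_ne_zero, by simp [hc, hc']⟩
    · refine ⟨(starRingEnd ℂ) c₁, by simpa using hc', ?_⟩
      rw [mul_comm _ c₁, Complex.mul_conj, hc]
      simp [Complex.normSq_nonneg]
  · have hc' : (starRingEnd ℂ) c₀ ≠ 0 := by simpa using hc
    have hn := Complex.normSq_nonneg c₀
    have h' : 0 ≤ ((starRingEnd ℂ) c₀ * c₁).re := by
      have : (starRingEnd ℂ) c₀ * c₁ = (starRingEnd ℂ) (c₀ * (starRingEnd ℂ) c₁) := by simp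
      rwa [this, Complex.conj_re]
    rcases le_total 0 ((starRingEnd ℂ) c₀ * c₁).im with hi | hi
    · refine ⟨(starRingEnd ℂ) c₀, hc', ?_, ?_, h', hi⟩ <;>
        rw [mul_comm, Complex.mul_conj] <;> simp [hn]
    · refine ⟨Complex.I * (starRingEnd ℂ) c₀, mul_ne_zero Complex.I_ne_zero hc', ?_, ?_, ?_, ?_⟩
      · rw [mul_assoc, mul_comm _ c₀, Complex.mul_conj]; simp
      · rw [mul_assoc, mul_comm _ c₀, Complex.mul_conj]; simp [hn]
      · rw [mul_assoc]; simpa using hi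
      · rw [mul_assoc]; simpa using h'

variable {C : ConvexCone ℝ U}

/-- A zero real or imaginary part is removed by `1 - i` or `1 + i`, which makes the two parts equal.
Thus `C + iC` and its version with zero added have the same classes. -/
theorem exists_smul_mem {z : E} (hz : z ≠ 0) (h : κ.re z ∈ insert 0 (C : Set U))
    (h' : κ.im z ∈ insert 0 (C : Set U)) :
    ∃ l : ℂ, l ≠ 0 ∧ κ.re (l • z) ∈ C ∧ κ.im (l • z) ∈ C := by
  rcases h with h | h <;> rcases h' with h' | h'
  · exact (hz (κ.eq_zero h h')).elim
  · refine ⟨1 - Complex.I, fun h => by simpa using congrArg Complex.re h, ?_⟩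
    simpa [re_smul, im_smul, h] using h'
  · refine ⟨1 + Complex.I, fun h => by simpa using congrArg Complex.re h, ?_⟩
    simpa [re_smul, im_smul, h'] using h
  · exact ⟨1, one_ne_zero, by simpa using h, by simpa using h'⟩

theorem combination_mem {v₀ v₁ : U} (h₀ : v₀ ∈ C) (h₁ : v₁ ∈ C) {s t : ℝ} (hs : 0 ≤ s)
    (ht : 0 ≤ t) : s • v₀ + t • v₁ ∈ insert 0 (C : Set U) := by
  rcases hs.eq_or_lt with rfl | hs <;> rcases ht.eq_or_lt with rfl | ht
  · left; simp
  · right; simpa using C.smul_mem ht h₁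
  · right; simpa using C.smul_mem hs h₀
  · right; exact C.add_mem (C.smul_mem hs h₀) (C.smul_mem ht h₁)

theorem exists_smul_combination_mem {v₀ v₁ : U} (h₀ : v₀ ∈ C) (h₁ : v₁ ∈ C) {c₀ c₁ : ℂ}
    (h : 0 ≤ (c₀ * (starRingEnd ℂ) c₁).re) (hz : c₀ • κ.ι v₀ + c₁ • κ.ι v₁ ≠ 0) :
    ∃ l : ℂ, l ≠ 0 ∧ κ.re (l • (c₀ • κ.ι v₀ + c₁ • κ.ι v₁)) ∈ C ∧
      κ.im (l • (c₀ • κ.ι v₀ + c₁ • κ.ι v₁)) ∈ C := by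
  obtain ⟨l, hl, h1, h2, h3, h4⟩ := exists_rotate h
  obtain ⟨m, hm, h5, h6⟩ := κ.exists_smul_mem (C := C) (smul_ne_zero hl hz) (by
    rw [smul_add, smul_smul, smul_smul, map_add, re_smul, re_smul, im_ι, im_ι, κ.re_ι, κ.re_ι,
      smul_zero, smul_zero, sub_zero, sub_zero]
    exact combination_mem h₀ h₁ h1 h3) (by
    rw [smul_add, smul_smul, smul_smul, map_add, im_smul, im_smul, im_ι, im_ι, κ.re_ι, κ.re_ι,
      smul_zero, smul_zero, zero_add, zero_add]
    exact combination_mem h₀ h₁ h2 h4)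
  exact ⟨m * l, mul_ne_zero hm hl, by rwa [mul_smul], by rwa [mul_smul]⟩

/-- The elliptic tube over the points of a convex cone `C` consists of the points with a
representative in `C + i C`. -/
theorem mk_mem_ellipticTube (φ : U →ₗ[ℝ] ℝ) (hφ : ∀ v ∈ C, 0 < φ v) {D : Set (ℙ ℝ U)}
    (hD : ∀ v hv, Projectivization.mk ℝ v hv ∈ D ↔ v ∈ C ∨ -v ∈ C) (z : E) (hz : z ≠ 0) :
    Projectivization.mk ℂ z hz ∈ ellipticTube κ.ι D ↔
      ∃ l : ℂ, l ≠ 0 ∧ κ.re (l • z) ∈ C ∧ κ.im (l • z) ∈ C := by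
  have hC0 : (0 : U) ∉ C := fun h => by simpa using hφ 0 h
  constructor
  · rintro ⟨v₀, v₁, hv₀, hv₁, hseg, c₀, c₁, hc, h0, hzc⟩
    suffices h : ∃ l : ℂ, l ≠ 0 ∧ κ.re (l • (c₀ • κ.ι v₀ + c₁ • κ.ι v₁)) ∈ C ∧
        κ.im (l • (c₀ • κ.ι v₀ + c₁ • κ.ι v₁)) ∈ C by
      obtain ⟨l, hl, h1, h2⟩ := h
      obtain ⟨m, hm⟩ := (Projectivization.mk_eq_mk_iff ℂ _ _ h0 hz).1 hzc.symm
      refine ⟨l * m, mul_ne_zero hl m.ne_zero, ?_⟩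
      rw [mul_smul]
      change κ.re (l • (m • z)) ∈ C ∧ κ.im (l • (m • z)) ∈ C
      rw [hm]
      exact ⟨h1, h2⟩
    have m₀ : v₀ ∈ C ∨ -v₀ ∈ C := (hD v₀ hv₀).1 (hseg ⟨1, 0, by simp, by simpa using hv₀, by simp⟩)
    have m₁ : v₁ ∈ C ∨ -v₁ ∈ C := (hD v₁ hv₁).1 (hseg ⟨0, 1, by simp, by simpa using hv₁, by simp⟩)
    -- With opposite signs the segment crosses the kernel of `φ`, which misses `D`, unless it is a
    -- single point.
    have opp : φ v₀ * φ v₁ < 0 → ∃ r : ℝ, v₁ = r • v₀ := by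
      intro hneg
      by_contra hcon
      push Not at hcon
      have hφ₀ : φ v₀ ≠ 0 := fun h => by simp [h] at hneg
      have hne : (-φ v₁) • v₀ + φ v₀ • v₁ ≠ 0 := by
        intro h
        refine hcon ((φ v₀)⁻¹ * φ v₁) ?_
        have h2 : φ v₀ • v₁ = φ v₁ • v₀ := by
          rw [neg_smul, neg_add_eq_zero] at h
          exact h.symm
        rw [mul_smul, ← h2, smul_smul, inv_mul_cancel₀ hφ₀, one_smul]
      have hφw : φ ((-φ v₁) • v₀ + φ v₀ • v₁) = 0 := by
        simp only [map_add, map_smul, smul_eq_mul]; ring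
      rcases (hD _ hne).1 (hseg ⟨-φ v₁, φ v₀, by nlinarith, hne, rfl⟩) with h | h
      · exact (hφ _ h).ne' hφw
      · have := hφ _ h
        rw [map_neg, hφw] at this
        simp at this
    have prop : ∀ u : U, u ∈ C → (∃ c : ℂ, c₀ • κ.ι v₀ + c₁ • κ.ι v₁ = c • κ.ι u) →
        ∃ l : ℂ, l ≠ 0 ∧ κ.re (l • (c₀ • κ.ι v₀ + c₁ • κ.ι v₁)) ∈ C ∧
        κ.im (l • (c₀ • κ.ι v₀ + c₁ • κ.ι v₁)) ∈ C := by
      rintro u hu ⟨c, hcu⟩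
      have := κ.exists_smul_combination_mem (C := C) hu hu (c₀ := c) (c₁ := 0) (by simp)
        (by simpa [← hcu] using h0)
      simpa [← hcu] using this
    have hcast : ∀ r : ℝ, ∀ u : U, κ.ι (r • u) = (r : ℂ) • κ.ι u := fun r u => by
      rw [map_smul, ofReal_smul_eq]
    rcases m₀ with m₀ | m₀ <;> rcases m₁ with m₁ | m₁
    · exact κ.exists_smul_combination_mem m₀ m₁ hc h0
    · have h1 := hφ _ m₁
      rw [map_neg] at h1
      obtain ⟨r, rfl⟩ := opp (by nlinarith [hφ _ m₀])
      exact prop v₀ m₀ ⟨c₀ + c₁ * r, by rw [hcast, add_smul, mul_smul]⟩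
    · have h1 := hφ _ m₀
      rw [map_neg] at h1
      obtain ⟨r, rfl⟩ := opp (by nlinarith [hφ _ m₁])
      refine prop (-v₀) m₀ ⟨-(c₀ + c₁ * r), ?_⟩
      rw [hcast, map_neg]
      module
    · have := κ.exists_smul_combination_mem m₀ m₁ (c₀ := -c₀) (c₁ := -c₁) (by simpa using hc)
        (by simpa using h0)
      simpa using this
  · rintro ⟨l, hl, h, h'⟩
    have hv : κ.re (l • z) ≠ 0 := fun e => hC0 (e ▸ h)
    have hv' : κ.im (l • z) ≠ 0 := fun e => hC0 (e ▸ h')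
    have hz' : l⁻¹ • κ.ι (κ.re (l • z)) + (l⁻¹ * Complex.I) • κ.ι (κ.im (l • z)) = z := by
      rw [mul_smul, ← smul_add, κ.re_add_im, smul_smul, inv_mul_cancel₀ hl, one_smul]
    -- The real and imaginary parts of `l • z` serve as extremes; the coefficients differ by the
    -- factor `i`, so `Re (c₀ * conj c₁) = 0`.
    refine ⟨_, _, hv, hv', ?_, l⁻¹, l⁻¹ * Complex.I, ?_, by rwa [hz'], ?_⟩
    · rintro x ⟨s, t, hst, h0, rfl⟩
      rw [hD]
      have hne : ∀ s t : ℝ, 0 ≤ s → 0 ≤ t → s • κ.re (l • z) + t • κ.im (l • z) ≠ 0 →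
          s • κ.re (l • z) + t • κ.im (l • z) ∈ C :=
        fun s t hs ht h0 => (combination_mem h h' hs ht).resolve_left h0
      rcases mul_nonneg_iff.1 hst with ⟨hs, ht⟩ | ⟨hs, ht⟩
      · exact Or.inl (hne s t hs ht h0)
      · right
        have e : -(s • κ.re (l • z) + t • κ.im (l • z)) =
            (-s) • κ.re (l • z) + (-t) • κ.im (l • z) := by module
        rw [e]
        exact hne _ _ (by linarith) (by linarith) (e ▸ neg_ne_zero.2 h0)
    · rw [map_mul, Complex.conj_I, ← mul_assoc, Complex.mul_conj]
      simp
    · congr 1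
      exact hz'.symm

end Algebra

/-! ### Openness and `ℂ`-convexity of tubes -/

section Convexity

variable {U E : Type*} [NormedAddCommGroup U] [NormedSpace ℝ U]
  [NormedAddCommGroup E] [NormedSpace ℂ E] [NormedSpace ℝ E] [IsScalarTower ℝ ℂ E]
  [FiniteDimensional ℝ E] (κ : Complexification U E)

/-- The complex linear extension of a real functional. -/
noncomputable def extend (φ : StrongDual ℝ U) : StrongDual ℂ E :=
  have : FiniteDimensional ℂ E := FiniteDimensional.right ℝ ℂ E
  LinearMap.toContinuousLinearMap
    { toFun := fun z => (φ (κ.re z) : ℂ) + φ (κ.im z) * Complex.I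
      map_add' := fun x y => by simp only [map_add, Complex.ofReal_add]; ring
      map_smul' := fun l z => by
        rw [re_smul, im_smul]
        apply Complex.ext <;> simp }

theorem extend_apply (φ : StrongDual ℝ U) (z : E) :
    κ.extend φ z = (φ (κ.re z) : ℂ) + φ (κ.im z) * Complex.I := rfl

variable {C : ConvexCone ℝ U} (φ : StrongDual ℝ U) (hφ : ∀ v ∈ C, 0 < φ v) {D : Set (ℙ ℝ U)}
    (hD : ∀ v hv, Projectivization.mk ℝ v hv ∈ D ↔ v ∈ C ∨ -v ∈ C)

include hφ

theorem extend_ne_zero {z : E} (h : κ.re z ∈ C) : κ.extend φ z ≠ 0 := fun e => by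
  have := congrArg Complex.re e
  simp [extend_apply, (hφ _ h).ne'] at this

include hD

theorem extend_rep_ne_zero : ∀ t ∈ ellipticTube κ.ι D, κ.extend φ t.rep ≠ 0 := by
  intro t ht h0
  rw [← t.mk_rep, κ.mk_mem_ellipticTube φ.toLinearMap hφ hD] at ht
  obtain ⟨l, -, hl, -⟩ := ht
  exact κ.extend_ne_zero φ hφ hl (by rw [map_smul, h0, smul_zero])

theorem isOpen_ellipticTube (hC : IsOpen (C : Set U)) : IsOpen (ellipticTube κ.ι D) := by
  have hM : IsOpen {z : E | κ.re z ∈ C ∧ κ.im z ∈ C} :=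
    (hC.preimage κ.re.continuous_of_finiteDimensional).inter (hC.preimage κ.im.continuous_of_finiteDimensional)
  have : ellipticTube κ.ι D = Projectivization.mk' ℂ ''
      (Subtype.val ⁻¹' {z : E | κ.re z ∈ C ∧ κ.im z ∈ C} : Set {z : E // z ≠ 0}) := by
    ext t
    induction t with | h z hz => ?_
    rw [κ.mk_mem_ellipticTube φ.toLinearMap hφ hD]
    constructor
    · rintro ⟨l, hl, h⟩
      exact ⟨⟨l • z, smul_ne_zero hl hz⟩, h,
        (Projectivization.mk_eq_mk_iff' ℂ _ _ _ _).2 ⟨l, rfl⟩⟩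
    · rintro ⟨⟨w, hw⟩, h, e⟩
      obtain ⟨l, rfl⟩ := (Projectivization.mk_eq_mk_iff ℂ w z hw hz).1 e
      exact ⟨l, l.ne_zero, h⟩
  rw [this]
  exact isOpenQuotientMap_mk'.isOpenMap _ (hM.preimage continuous_subtype_val)

theorem isCConvex_of_isOpen (hC : IsOpen (C : Set U)) : IsCConvex (ellipticTube κ.ι D) := by
  refine isCConvex_of_contractible (κ.extend φ) (κ.extend_rep_ne_zero φ hφ hD)
    fun W _ hne => ?_
  refine contractibleSpace_of_open_cone (κ.extend φ) (W := W)
    (M := {z : E | κ.re z ∈ C ∧ κ.im z ∈ C})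
    ((hC.preimage κ.re.continuous_of_finiteDimensional).inter (hC.preimage κ.im.continuous_of_finiteDimensional)) ?_ ?_ ?_ ?_ hne
  · intro x hx y hy
    exact ⟨by rw [map_add]; exact C.add_mem hx.1 hy.1, by rw [map_add]; exact C.add_mem hx.2 hy.2⟩
  · intro c hc x hx
    exact ⟨by rw [map_smul]; exact C.smul_mem hc hx.1, by rw [map_smul]; exact C.smul_mem hc hx.2⟩
  · exact fun x hx => κ.extend_ne_zero φ hφ hx.1
  · intro z hz
    rw [mem_inter_iff, κ.mk_mem_ellipticTube φ.toLinearMap hφ hD]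
    constructor
    · rintro ⟨⟨l, hl, h⟩, hW⟩
      exact ⟨l, hl, h, W.smul_mem l hW⟩
    · rintro ⟨l, hl, h, hW⟩
      exact ⟨⟨l, hl, h⟩, (W.smul_mem_iff hl).1 hW⟩

theorem isCConvex_of_isClosed (hC : IsClosed (insert 0 (C : Set U))) :
    IsCConvex (ellipticTube κ.ι D) := by
  have hadd : ∀ x ∈ insert 0 (C : Set U), ∀ y ∈ insert 0 (C : Set U),
      x + y ∈ insert 0 (C : Set U) := by
    rintro x (rfl | hx) y (rfl | hy)
    · simp
    · right; simpa using hy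
    · right; simpa using hx
    · right; exact C.add_mem hx hy
  have hsmul : ∀ c : ℝ, 0 ≤ c → ∀ x ∈ insert 0 (C : Set U), c • x ∈ insert 0 (C : Set U) := by
    rintro c hc x (rfl | hx)
    · simp
    · rcases hc.eq_or_lt with rfl | hc
      · simp
      · right; exact C.smul_mem hc hx
  have hpos : ∀ x ∈ insert 0 (C : Set U), 0 ≤ φ x := by
    rintro x (rfl | hx)
    · simp
    · exact (hφ x hx).le
  have hzero : ∀ x ∈ insert 0 (C : Set U), φ x = 0 → x = 0 := by
    rintro x (rfl | hx) h
    · rfl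
    · exact ((hφ x hx).ne' h).elim
  -- `ψ` cuts out the compact base of the closed cone of vectors with both parts in `C ∪ {0}`.
  let ψ : StrongDual ℝ E := (φ.toLinearMap ∘ₗ (κ.re + κ.im)).toContinuousLinearMap
  have hψ : ∀ z, ψ z = φ (κ.re z) + φ (κ.im z) := fun z => map_add φ _ _
  have hkey : ∀ z : E, κ.re z ∈ insert 0 (C : Set U) → κ.im z ∈ insert 0 (C : Set U) → z ≠ 0 →
      0 < ψ z := by
    intro z h h' hz
    rw [hψ]
    refine (add_nonneg (hpos _ h) (hpos _ h')).lt_of_ne fun e => hz ?_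
    obtain ⟨h1, h2⟩ := (add_eq_zero_iff_of_nonneg (hpos _ h) (hpos _ h')).1 e.symm
    exact κ.eq_zero (hzero _ h h1) (hzero _ h' h2)
  refine isCConvex_of_contractible (κ.extend φ) (κ.extend_rep_ne_zero φ hφ hD)
    fun W _ hne => ?_
  refine contractibleSpace_of_closed_cone (κ.extend φ) (M := {z : E | κ.re z ∈ insert 0 (C : Set U) ∧
      κ.im z ∈ insert 0 (C : Set U)} ∩ (W : Set E))
    (IsClosed.inter ((hC.preimage κ.re.continuous_of_finiteDimensional).inter (hC.preimage κ.im.continuous_of_finiteDimensional)) ?_)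
    ?_ ?_ ψ ?_ ?_ ?_ hne
  · exact (W.restrictScalars ℝ).closed_of_finiteDimensional
  · intro x hx y hy
    exact ⟨⟨by rw [map_add]; exact hadd _ hx.1.1 _ hy.1.1,
      by rw [map_add]; exact hadd _ hx.1.2 _ hy.1.2⟩, W.add_mem hx.2 hy.2⟩
  · intro c hc x hx
    exact ⟨⟨by rw [map_smul]; exact hsmul c hc _ hx.1.1,
      by rw [map_smul]; exact hsmul c hc _ hx.1.2⟩, W.smul_of_tower_mem c hx.2⟩
  · exact fun x hx h0 => hkey x hx.1.1 hx.1.2 h0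
  · intro x hx h0 e
    have h1 := congrArg Complex.re e
    have h2 := congrArg Complex.im e
    simp only [extend_apply, Complex.add_re, Complex.ofReal_re, Complex.mul_re, Complex.I_re,
      Complex.ofReal_im, Complex.I_im, Complex.add_im, Complex.mul_im, Complex.zero_re,
      Complex.zero_im] at h1 h2
    have := hkey x hx.1.1 hx.1.2 h0
    rw [hψ] at this
    linarith
  · intro z hz
    rw [mem_inter_iff, κ.mk_mem_ellipticTube φ.toLinearMap hφ hD]
    constructor
    · rintro ⟨⟨l, hl, h⟩, hW⟩
      exact ⟨l, hl, ⟨Or.inr h.1, Or.inr h.2⟩, W.smul_mem l hW⟩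
    · rintro ⟨l, hl, h, hW⟩
      obtain ⟨m, hm, h1⟩ := κ.exists_smul_mem (smul_ne_zero hl hz) h.1 h.2
      refine ⟨⟨m * l, mul_ne_zero hm hl, ?_⟩, (W.smul_mem_iff hl).1 hW⟩
      rwa [mul_smul]

end Convexity

end Complexification

/-! ### Dual complements and the duality of tubes -/

section Duality

theorem mk_mem_ker {K V : Type*} [NormedField K] [NormedAddCommGroup V] [NormedSpace K V]
    {ξ : StrongDual K V} {v : V} (hξ : ξ ≠ 0) (hv : v ≠ 0) :
    Projectivization.mk K v hv ∈ ker (Projectivization.mk K ξ hξ) ↔ ξ v = 0 := by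
  obtain ⟨a, ha⟩ := Projectivization.exists_smul_eq_mk_rep K v hv
  obtain ⟨b, hb⟩ := Projectivization.exists_smul_eq_mk_rep K ξ hξ
  change (Projectivization.mk K ξ hξ).rep (Projectivization.mk K v hv).rep = 0 ↔ _
  rw [← ha, ← hb]
  simp [Units.smul_def]

variable {U : Type*} [NormedAddCommGroup U] [NormedSpace ℝ U]

/-- A functional without zeros on a convex cone has constant sign there: opposite values would
cancel in a positive combination. -/
theorem mk_mem_dualComplement {C : ConvexCone ℝ U} (hC : ∀ v ∈ C, -v ∉ C)
    (hne : (C : Set U).Nonempty) {D : Set (ℙ ℝ U)}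
    (hD : ∀ v hv, Projectivization.mk ℝ v hv ∈ D ↔ v ∈ C ∨ -v ∈ C) (ξ : StrongDual ℝ U)
    (hξ : ξ ≠ 0) :
    Projectivization.mk ℝ ξ hξ ∈ dualComplement D ↔ ξ ∈ posDual C ∨ -ξ ∈ posDual C := by
  have h0 := zero_notMem_of_salient hC
  constructor
  · intro h
    have hker : ∀ v ∈ C, ξ v ≠ 0 := by
      intro v hv e
      have hv0 : v ≠ 0 := fun e => h0 (e ▸ hv)
      have : Projectivization.mk ℝ v hv0 ∈ ker (Projectivization.mk ℝ ξ hξ) ∩ D :=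
        ⟨(mk_mem_ker hξ hv0).2 e, (hD v hv0).2 (Or.inl hv)⟩
      rw [show ker (Projectivization.mk ℝ ξ hξ) ∩ D = ∅ from h] at this
      exact this
    have opp : ∀ v ∈ C, ∀ w ∈ C, 0 < ξ v → ξ w < 0 → False := by
      intro v hv w hw h1 h2
      refine hker _ (C.add_mem (C.smul_mem (neg_pos.2 h2) hv) (C.smul_mem h1 hw)) ?_
      simp only [map_add, map_smul, smul_eq_mul]
      ring
    obtain ⟨v₀, hv₀⟩ := hne
    rcases (hker v₀ hv₀).lt_or_gt with h | h
    · refine Or.inr fun v hv => neg_pos.2 ((hker v hv).lt_or_gt.resolve_right fun h' => ?_)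
      exact opp v hv v₀ hv₀ h' h
    · refine Or.inl fun v hv => (hker v hv).lt_or_gt.resolve_left fun h' => ?_
      exact opp v₀ hv₀ v hv h h'
  · intro h
    have hker : ∀ v ∈ C, ξ v ≠ 0 := by
      intro v hv
      rcases h with h | h
      · exact (h v hv).ne'
      · exact (neg_pos.1 (h v hv)).ne
    refine eq_empty_of_forall_notMem fun x hx => ?_
    induction x with | h v hv => ?_
    have h1 := (mk_mem_ker hξ hv).1 hx.1
    rcases (hD v hv).1 hx.2 with h2 | h2
    · exact hker v h2 h1
    · exact hker _ h2 (by rw [map_neg, h1, neg_zero])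

theorem mk_mem_dualComplement' {E : Type*} [NormedAddCommGroup E] [NormedSpace ℂ E]
    {F : Set (ℙ ℂ (StrongDual ℂ E))} {z : E} (hz : z ≠ 0) :
    Projectivization.mk ℂ z hz ∈ dualComplement' F ↔
      ∀ ζ hζ, Projectivization.mk ℂ ζ hζ ∈ F → ζ z ≠ 0 := by
  constructor
  · intro h ζ hζ hF e
    have : Projectivization.mk ℂ ζ hζ ∈ ann (Projectivization.mk ℂ z hz) ∩ F :=
      ⟨(mk_mem_ker hζ hz).2 e, hF⟩
    rw [show ann (Projectivization.mk ℂ z hz) ∩ F = ∅ from h] at this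
    exact this
  · intro h
    refine eq_empty_of_forall_notMem fun x hx => ?_
    induction x with | h ζ hζ => ?_
    exact h ζ hζ hx.2 ((mk_mem_ker hζ hz).1 hx.1)

variable {E : Type*} [NormedAddCommGroup E] [NormedSpace ℂ E] [NormedSpace ℝ E]
  [IsScalarTower ℝ ℂ E] [FiniteDimensional ℝ U]
  [FiniteDimensional ℝ (StrongDual ℂ E)]

/-- If no functional in `P + i P`, with `P` the open dual cone of `C`, vanishes at `z`, then some
multiple of `z` belongs to the closure of `C + i C`. -/
theorem exists_smul_mem_of_forall_ne_zero (κ : Complexification U E)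
    (κ' : Complexification (StrongDual ℝ U) (StrongDual ℂ E))
    (hpair : ∀ ζ z, ζ z = ((κ'.re ζ (κ.re z) - κ'.im ζ (κ.im z) : ℝ) : ℂ) +
      ((κ'.re ζ (κ.im z) + κ'.im ζ (κ.re z) : ℝ) : ℂ) * Complex.I)
    {C : ConvexCone ℝ U} (hC : ∀ v ∈ C, -v ∉ C) (hcl : IsClosed (insert 0 (C : Set U)))
    {z : E} (hz : z ≠ 0)
    (h : ∀ ζ, κ'.re ζ ∈ posDual C → κ'.im ζ ∈ posDual C → ζ z ≠ 0) :
    ∃ l : ℂ, l ≠ 0 ∧ κ.re (l • z) ∈ insert 0 (C : Set U) ∧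
      κ.im (l • z) ∈ insert 0 (C : Set U) := by
  have hP := isOpen_posDual hC hcl
  let M : Set (StrongDual ℂ E) := {ζ | κ'.re ζ ∈ posDual C ∧ κ'.im ζ ∈ posDual C}
  have hM : IsOpen M := (hP.preimage κ'.re.continuous_of_finiteDimensional).inter
    (hP.preimage κ'.im.continuous_of_finiteDimensional)
  have hMconv : Convex ℝ M := by
    refine convex_iff_forall_pos.2 fun x hx y hy s t hs ht _ => ⟨?_, ?_⟩
    · rw [map_add, map_smul, map_smul]
      exact (posDual C).add_mem ((posDual C).smul_mem hs hx.1) ((posDual C).smul_mem ht hy.1)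
    · rw [map_add, map_smul, map_smul]
      exact (posDual C).add_mem ((posDual C).smul_mem hs hx.2) ((posDual C).smul_mem ht hy.2)
  let ev : StrongDual ℂ E →ₗ[ℝ] ℂ :=
    { toFun := fun ζ => ζ z
      map_add' := fun _ _ => rfl
      map_smul' := fun _ _ => rfl }
  have hsurj : Function.Surjective ev := by
    intro c
    obtain ⟨f, -, hf⟩ := exists_dual_vector ℂ z (norm_ne_zero_iff.2 hz)
    have hf0 : f z ≠ 0 := by rw [hf]; simpa using hz
    refine ⟨(c * (f z)⁻¹) • f, ?_⟩
    change (c * (f z)⁻¹) • f z = c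
    rw [smul_eq_mul, inv_mul_cancel_right₀ hf0]
  have hopen : IsOpen (ev '' M) := ev.isOpenMap_of_finiteDimensional hsurj _ hM
  have h0 : (0 : ℂ) ∉ ev '' M := by
    rintro ⟨ζ, hζ, e⟩
    exact h ζ hζ.1 hζ.2 e
  obtain ⟨f, hf⟩ := geometric_hahn_banach_open_point (hMconv.linear_image ev) hopen h0
  have hfxy : ∀ x y : ℝ, f ((x : ℂ) + (y : ℂ) * Complex.I) = x * f 1 + y * f Complex.I := by
    intro x y
    have e : (x : ℂ) + (y : ℂ) * Complex.I = x • (1 : ℂ) + y • Complex.I := by simp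
    rw [e, map_add, map_smul, map_smul, smul_eq_mul, smul_eq_mul]
  set p := f 1 with hp
  set q := f Complex.I with hq
  set a := κ.re z with ha
  set b := κ.im z with hb
  obtain ⟨φ, hφ⟩ := posDual_nonempty hC hcl
  -- The separation `f (ζ z) < 0` for `ζ = α + iβ`, regrouped by `α` and `β`. Since `α` and `β` can
  -- be scaled independently, each term is nonpositive.
  have key : ∀ α ∈ posDual C, ∀ β ∈ posDual C, α (p • a + q • b) + β (q • a - p • b) < 0 := by
    intro α hα β hβ
    have hre : κ'.re (κ'.ι α + Complex.I • κ'.ι β) = α := by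
      rw [map_add, κ'.re_ι, κ'.re_I_smul_ι, add_zero]
    have him : κ'.im (κ'.ι α + Complex.I • κ'.ι β) = β := by
      rw [map_add, κ'.im_ι, κ'.im_smul, κ'.im_ι, κ'.re_ι]
      simp
    have hmem : κ'.ι α + Complex.I • κ'.ι β ∈ M :=
      ⟨by rw [hre]; exact hα, by rw [him]; exact hβ⟩
    have h1 := hf _ ⟨_, hmem, rfl⟩
    change f ((κ'.ι α + Complex.I • κ'.ι β) z) < f 0 at h1
    rw [hpair, hre, him, hfxy, map_zero] at h1
    simp only [map_add, map_sub, map_smul, smul_eq_mul]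
    linarith
  have scale : ∀ x c : ℝ, (∀ t : ℝ, 0 < t → t * x + c < 0) → x ≤ 0 := by
    intro x c hx
    by_contra hpos
    push Not at hpos
    have := hx ((|c| + 1) / x) (by positivity)
    rw [div_mul_cancel₀ _ hpos.ne'] at this
    linarith [neg_abs_le c]
  have hA : ∀ α ∈ posDual C, α (p • a + q • b) ≤ 0 := fun α hα =>
    scale _ (φ (q • a - p • b)) fun t ht => key (t • α) ((posDual C).smul_mem ht hα) φ hφ
  have hB : ∀ β ∈ posDual C, β (q • a - p • b) ≤ 0 := fun β hβ =>
    scale _ (φ (p • a + q • b)) fun t ht => by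
      rw [add_comm]; exact key φ hφ (t • β) ((posDual C).smul_mem ht hβ)
  -- For `l = -q - ip`, the parts of `l • z` are `-(q a - p b)` and `-(p a + q b)`, to which the
  -- bipolar theorem applies.
  refine ⟨⟨-q, -p⟩, fun e => ?_, ?_, ?_⟩
  · have h1 : q = 0 := by simpa using congrArg Complex.re e
    have h2 : p = 0 := by simpa using congrArg Complex.im e
    have := key φ hφ φ hφ
    simp [h1, h2] at this
  · refine mem_of_posDual_nonneg hC hcl fun β hβ => ?_
    have := hB β hβ
    rw [κ.re_smul]
    simp only [map_sub, map_smul, smul_eq_mul] at this ⊢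
    linarith
  · refine mem_of_posDual_nonneg hC hcl fun α hα => ?_
    have := hA α hα
    rw [κ.im_smul]
    simp only [map_add, map_smul, smul_eq_mul] at this ⊢
    linarith

theorem ellipticTube_eq_dualComplement' (κ : Complexification U E)
    (κ' : Complexification (StrongDual ℝ U) (StrongDual ℂ E))
    (hpair : ∀ ζ z, ζ z = ((κ'.re ζ (κ.re z) - κ'.im ζ (κ.im z) : ℝ) : ℂ) +
      ((κ'.re ζ (κ.im z) + κ'.im ζ (κ.re z) : ℝ) : ℂ) * Complex.I)
    {C : ConvexCone ℝ U} (hC : ∀ v ∈ C, -v ∉ C) (hcl : IsClosed (insert 0 (C : Set U)))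
    (hne : (C : Set U).Nonempty) {D : Set (ℙ ℝ U)}
    (hD : ∀ v hv, Projectivization.mk ℝ v hv ∈ D ↔ v ∈ C ∨ -v ∈ C) :
    ellipticTube κ.ι D = dualComplement' (ellipticTube κ'.ι (dualComplement D)) := by
  obtain ⟨φ, hφ⟩ := posDual_nonempty hC hcl
  obtain ⟨v₀, hv₀⟩ := hne
  have htube := κ.mk_mem_ellipticTube φ.toLinearMap hφ hD
  have htube' := κ'.mk_mem_ellipticTube (C := posDual C)
    (ContinuousLinearMap.apply ℝ ℝ v₀).toLinearMap (fun ξ hξ => hξ v₀ hv₀)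
    (mk_mem_dualComplement hC ⟨v₀, hv₀⟩ hD)
  ext x
  induction x with | h z hz => ?_
  rw [htube, mk_mem_dualComplement']
  constructor
  · rintro ⟨l, hl, h1, h2⟩ ζ hζ hmem e
    obtain ⟨m, hm, h3, h4⟩ := (htube' ζ hζ).1 hmem
    have h5 : (m • ζ) (l • z) = 0 := by
      rw [smul_apply, map_smul, e, smul_zero, smul_zero]
    rw [hpair] at h5
    -- For `α + iβ` in `P + iP` and `a + ib` in `C + iC`, the imaginary part `α b + β a` of the
    -- pairing is positive.
    have h6 := congrArg Complex.im h5
    simp only [Complex.add_im, Complex.ofReal_im, Complex.mul_im, Complex.ofReal_re, Complex.I_im,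
      Complex.I_re, Complex.zero_im] at h6
    have h7 := h3 _ h2
    have h8 := h4 _ h1
    linarith
  · intro h
    obtain ⟨l, hl, h1, h2⟩ := exists_smul_mem_of_forall_ne_zero κ κ' hpair hC hcl hz
      fun ζ h1 h2 e => by
        have hζ : ζ ≠ 0 := by
          rintro rfl
          have := h1 v₀ hv₀
          simp at this
        exact h ζ hζ ((htube' ζ hζ).2 ⟨1, one_ne_zero, by rwa [one_smul], by rwa [one_smul]⟩) e
    obtain ⟨m, hm, h3, h4⟩ := κ.exists_smul_mem (smul_ne_zero hl hz) h1 h2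
    exact ⟨m * l, mul_ne_zero hm hl, by rwa [mul_smul], by rwa [mul_smul]⟩

end Duality

/-! ### The coordinate complexifications of the space and its dual -/

section Coordinates

variable (n : ℕ)

/-- `ℂⁿ⁺¹` as the complexification of `ℝⁿ⁺¹`. -/
noncomputable def coordComplexification :
    Complexification (Fin (n + 1) → ℝ) (Fin (n + 1) → ℂ) where
  ι :=
    { toFun := complexify
      map_add' := fun v w => by ext i; simp [complexify]
      map_smul' := fun c v => by ext i; simp [complexify] }
  re :=
    { toFun := fun z i => (z i).re
      map_add' := fun v w => by ext i; simp
      map_smul' := fun c v => by ext i; simp }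
  re_ι v := by ext i; simp [complexify]
  re_I_smul_ι v := by ext i; simp [complexify]
  decomp z := by
    ext i
    apply Complex.ext <;> simp [complexify]

variable {n}

theorem complexifyDual_complexify (ξ : StrongDual ℝ (Fin (n + 1) → ℝ)) (v : Fin (n + 1) → ℝ) :
    complexifyDual ξ (complexify v) = (ξ v : ℂ) := by
  have h : ξ v = ∑ i, v i * ξ (Pi.single i 1) := by
    conv_lhs => rw [pi_eq_sum_univ' v, map_sum]
    simp
  rw [h]
  simp [complexifyDual, complexify, mul_comm]

/-- Complex functionals are determined by their values on real vectors. -/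
theorem apply_eq_of_complexify (ζ : StrongDual ℂ (Fin (n + 1) → ℂ)) (z : Fin (n + 1) → ℂ) :
    ζ z = ζ (complexify ((coordComplexification n).re z)) +
      Complex.I * ζ (complexify ((coordComplexification n).im z)) := by
  conv_lhs => rw [← (coordComplexification n).re_add_im z, map_add, map_smul]
  rfl

variable (n)

/-- The dual of `ℂⁿ⁺¹` as the complexification of the dual of `ℝⁿ⁺¹`. -/
noncomputable def dualComplexification :
    Complexification (StrongDual ℝ (Fin (n + 1) → ℝ)) (StrongDual ℂ (Fin (n + 1) → ℂ)) where
  ι :=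
    { toFun := complexifyDual
      map_add' := fun ξ η => by
        ext z
        simp [complexifyDual, add_mul, Finset.sum_add_distrib]
      map_smul' := fun c ξ => by
        ext z
        simp [complexifyDual, Finset.mul_sum, mul_assoc] }
  re :=
    { toFun := fun ζ => Complex.reCLM.comp ((ζ.restrictScalars ℝ).comp
        ((coordComplexification n).ι.toContinuousLinearMap))
      map_add' := fun ζ η => by ext v; simp
      map_smul' := fun c ζ => by ext v; simp }
  re_ι ξ := by
    ext v
    change (complexifyDual ξ (complexify v)).re = ξ v
    rw [complexifyDual_complexify, Complex.ofReal_re]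
  re_I_smul_ι ξ := by
    ext v
    change (Complex.I * complexifyDual ξ (complexify v)).re = 0
    rw [complexifyDual_complexify]
    simp
  decomp ζ := by
    have key : ∀ v, (complexifyDual (Complex.reCLM.comp ((ζ.restrictScalars ℝ).comp
        ((coordComplexification n).ι.toContinuousLinearMap))) + Complex.I • complexifyDual
        (-(Complex.reCLM.comp (((Complex.I • ζ).restrictScalars ℝ).comp
        ((coordComplexification n).ι.toContinuousLinearMap))))) (complexify v) =
        ζ (complexify v) := by
      intro v
      rw [add_apply, smul_apply, complexifyDual_complexify, complexifyDual_complexify]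
      change ((ζ (complexify v)).re : ℂ) + Complex.I * ((-(Complex.I * ζ (complexify v)).re : ℝ) : ℂ)
        = ζ (complexify v)
      apply Complex.ext <;> simp
    refine ContinuousLinearMap.ext fun z => ?_
    rw [apply_eq_of_complexify ζ z, ← key, ← key]
    exact apply_eq_of_complexify _ z

theorem dualComplexification_pairing (ζ : StrongDual ℂ (Fin (n + 1) → ℂ))
    (z : Fin (n + 1) → ℂ) :
    ζ z = (((dualComplexification n).re ζ ((coordComplexification n).re z) -
        (dualComplexification n).im ζ ((coordComplexification n).im z) : ℝ) : ℂ) +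
      (((dualComplexification n).re ζ ((coordComplexification n).im z) +
        (dualComplexification n).im ζ ((coordComplexification n).re z) : ℝ) : ℂ) * Complex.I := by
  have hre : ∀ v, (dualComplexification n).re ζ v = (ζ (complexify v)).re := fun v => rfl
  have him : ∀ v, (dualComplexification n).im ζ v = (ζ (complexify v)).im := fun v => by
    change -(Complex.I * ζ (complexify v)).re = _
    simp
  rw [apply_eq_of_complexify ζ z, hre, hre, him, him]
  apply Complex.ext
  · simp [sub_eq_add_neg]
  · simp [add_comm]

end Coordinates

end EllipticTube

/-! ### The corollary -/

open EllipticTube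

theorem mainTheorem11 (n : ℕ) (D : Set (ℙ ℝ (Fin (n + 1) → ℝ)))
    (hcomp : IsCompact D) (hconv : EllipticTube.IsConvex D) :
    EllipticTube.IsCConvex (EllipticTube.tube D) ∧
      (D.Nonempty →
        IsOpen (EllipticTube.dualTube (EllipticTube.dualComplement D)) ∧
        EllipticTube.IsCConvex (EllipticTube.dualTube (EllipticTube.dualComplement D)) ∧
        EllipticTube.tube D =
          EllipticTube.dualComplement'
            (EllipticTube.dualTube (EllipticTube.dualComplement D))) := by
  have : FiniteDimensional ℝ (StrongDual ℂ (Fin (n + 1) → ℂ)) := FiniteDimensional.trans ℝ ℂ _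
  rcases D.eq_empty_or_nonempty with rfl | hne
  · refine ⟨?_, fun h => (Set.not_nonempty_empty h).elim⟩
    have hempty : ∀ t ∈ tube (n := n) ∅, False := by
      rintro t ⟨v₀, v₁, hv₀, -, hseg, -⟩
      exact hseg ⟨1, 0, by simp, by simpa using hv₀, rfl⟩
    -- The tube is empty, so the zero functional satisfies the nonvanishing condition vacuously.
    exact isCConvex_of_contractible 0 (fun t ht => (hempty t ht).elim)
      fun W _ ⟨t, ht⟩ => (hempty t ht.1).elim
  obtain ⟨C, hC, hcl, hCne, hD⟩ := exists_cone hcomp hconv hne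
  obtain ⟨φ, hφ⟩ := posDual_nonempty hC hcl
  have hD' := mk_mem_dualComplement hC hCne hD
  have hopen := isOpen_posDual hC hcl
  have htube : tube D = ellipticTube (coordComplexification n).ι D := rfl
  have hdual : dualTube (dualComplement D) =
      ellipticTube (dualComplexification n).ι (dualComplement D) := rfl
  rw [htube, hdual]
  refine ⟨(coordComplexification n).isCConvex_of_isClosed φ hφ hD hcl, fun _ => ?_⟩
  have hdualeq := ellipticTube_eq_dualComplement' (coordComplexification n)
    (dualComplexification n) (dualComplexification_pairing n) hC hcl hCne hD
  obtain ⟨v₀, hv₀⟩ := hCne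
  have hev : ∀ ξ ∈ posDual C, 0 < ContinuousLinearMap.apply ℝ ℝ v₀ ξ := fun ξ hξ => hξ v₀ hv₀
  exact ⟨(dualComplexification n).isOpen_ellipticTube _ hev hD' hopen,
    (dualComplexification n).isCConvex_of_isOpen _ hev hD' hopen, hdualeq⟩
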